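/- **Setting.** Let $1\le d_*<D$ be integers and let $X\subset\mathbb R^D$ be compact with $\|x\|\le 1$ for all $x\in X$. Let $\rho$ be a probability measure on $X\times\mathbb R$ such that $|y|\le M$ $\rho$-almost surely, for some $M>0$. Write $\mathcal R(f)=\int (f(x)-y)^2\,d\rho(x,y)$ and let $f_*(x)=\int y\,d\rho(y\mid x)$ be the regression function. Let $\mathcal B=\{B\in\mathbb R^{d_*\times D}:\ \sup_{\|x\|\le1}\|Bx\|\le 1\}$ and $\Omega=\{Bx : x\in X,\ B\in\mathcal B\}\subset\mathbb R^{d_*}$. Let $\mathcal H$ be a reproducing kernel Hilbert space on $\Omega$ with continuous kernel $k$, put $\kappa=\sup_{u\in\Omega}k(u,u)$, and assume that * for some $C_{\mathcal H}>0$: $|g(x')-g(x)|\le C_{\mathcal H}\|g\|_{\mathcal H}\|x'-x\|$ for all $g\in\mathcal H$ and $x,x'\in\Omega$; * for some $c_1>0$, $s^*>0$: $\log\mathcal N(\mathbb B_{\mathcal H,R},\epsilon)\le c_1(R/\epsilon)^{s^*}$ for all $R,\epsilon>0$, where $\mathcal N(\mathbb B_{\mathcal H,R},\epsilon)$ is the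 least number of closed sup-norm balls of radius $\epsilon$, centred in the ball $\mathbb B_{\mathcal H,R}=\{g\in\mathcal H:\|g\|_{\mathcal H}\le R\}$, that cover $\mathbb B_{\mathcal H,R}$. For $B\in\mathcal B$ let $\mathcal H_B$ be the RKHS on $X$ with kernel $k_B(x,x')=k(Bx,Bx')$ and norm $\|\cdot\|_B$. Fix $B_*\in\mathcal B$, $\lambda>0$ and $m\ge1$, and let $$\mathcal A(\lambda)=\inf_{f\in\mathcal H_{B_*}}\bigl(\mathcal R(f)-\mathcal R(f_*)+\lambda\|f\|_{B_*}^2\bigr).$$ Given an i.i.d. sample $(x_i,y_i)_{i=1}^m\sim\rho^m$, an HKRR estimator is any function $\hat f\in\mathcal H_{\hat B}$, $\hat B\in\mathcal B$, for which $(\hat B,\hat f)$ attains $$\min_{B\in\mathcal B}\ \min_{f\in\mathcal H_B}\ \frac1m\sum_{i=1}^m(f(x_i)-y_i)^2+\lambda\|f\|_B^2 .$$ **Theorem (basic error bound).** Let $\delta>0$. Then, with probability at least $1-\delta$ over the sample, every HKRR estimator $\hat f$ satisfies $$\mathcal R(\hat f)-\mathcal R(f_*)\le 2C_3\max\Bigl\{1,\frac{M^2}{\lambda}\Bigr\}\,D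 d_*\,\max\Bigl\{1,\log\frac2\delta\Bigr\}\Bigl(\frac1m\Bigr)^{\frac1{s^*+1}}+\Bigl(4+\frac{28\kappa^2\log(2/\delta)}{3m\lambda}\Bigr)\mathcal A(\lambda)+\frac{84M^2\log(2/\delta)}{m},$$ where $$C_3=360\,\max\{1,M+\kappa\}^2\,\bigl(1+c_1+\max\{0,\log(3C_{\mathcal H})\}\bigr).$$ -/

import Mathlib

open MeasureTheory ProbabilityTheory
open scoped NNReal ENNReal BoundedContinuousFunction

noncomputable section

namespace HKRR

/-- `ℝⁿ` with its Euclidean norm. -/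
abbrev Eucl (n : ℕ) : Type := EuclideanSpace ℝ (Fin n)

/-- The real-valued reproducing kernel `k(u, v)` of a real RKHS `H` of functions on `S`. -/
def kernelFun {S : Type*} (H : Type*) [NormedAddCommGroup H] [InnerProductSpace ℝ H]
    [CompleteSpace H] [RKHS ℝ H S ℝ] (u v : S) : ℝ :=
  RKHS.kernel H u v 1

/-- `κ = sup_{u ∈ S} k(u, u)`. -/
def kappa {S : Type*} (H : Type*) [NormedAddCommGroup H] [InnerProductSpace ℝ H]
    [CompleteSpace H] [RKHS ℝ H S ℝ] : ℝ :=
  ⨆ u : S, kernelFun H u u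

/-- The closed ball of radius `R` of an RKHS, as a set of bounded continuous functions with the
sup norm. (For a bounded continuous kernel all elements of `H` are such functions.) -/
def rkhsBall {S : Type*} [TopologicalSpace S] (H : Type*) [NormedAddCommGroup H]
    [InnerProductSpace ℝ H] [RKHS ℝ H S ℝ] (R : ℝ) : Set (S →ᵇ ℝ) :=
  {F | ∃ g : H, ‖g‖ ≤ R ∧ ∀ u : S, F u = g u}

/-- The covering number condition `log 𝒩(𝔹_{H,R}, ε) ≤ c₁ (R/ε)^s` for all `R, ε > 0`, where
`𝒩` is the least number of closed sup-norm balls of radius `ε`, centred in the set, that cover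
it. -/
def CoveringBound {S : Type*} [TopologicalSpace S] (H : Type*) [NormedAddCommGroup H]
    [InnerProductSpace ℝ H] [RKHS ℝ H S ℝ] (c₁ s : ℝ) : Prop :=
  ∀ R : ℝ, 0 < R → ∀ ε : ℝ≥0, 0 < ε →
    Metric.coveringNumber ε (rkhsBall (S := S) H R) ≠ ⊤ ∧
    Real.log ((Metric.coveringNumber ε (rkhsBall (S := S) H R)).toNat : ℝ) ≤ c₁ * (R / ε) ^ s

/-- The set `ℬ` of `d × D` matrices (as linear maps `ℝᴰ → ℝᵈ`) of operator norm at most one. -/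
abbrev LinMaps (d D : ℕ) : Type := {B : Eucl D →L[ℝ] Eucl d // ‖B‖ ≤ 1}

/-- `Ω = {B x : x ∈ X, B ∈ ℬ} ⊆ ℝᵈ`. -/
def latent {D : ℕ} (d : ℕ) (X : Set (Eucl D)) : Set (Eucl d) :=
  {u | ∃ B : LinMaps d D, ∃ x ∈ X, B.1 x = u}

section Hyper

variable {d D : ℕ} {X : Set (Eucl D)}

/-- The map `x ↦ B x` from `X` to `Ω`. -/
def toLatent (B : LinMaps d D) (x : X) : latent d X := ⟨B.1 x, B, x, x.2, rfl⟩

variable (H : Type*) [NormedAddCommGroup H] [InnerProductSpace ℝ H] [CompleteSpace H]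
  [RKHS ℝ H (latent d X) ℝ]

/-- The hyper-kernel `k_B(x, x') = k(B x, B x')` on `X`, where `k` is the kernel of `H`
(a kernel value `c` is encoded, as in Mathlib, by the linear map `t ↦ c t` on `ℝ`). -/
def hyperKernel (B : LinMaps d D) : Matrix X X (ℝ →L[ℝ] ℝ) :=
  (RKHS.kernel H).submatrix (toLatent B) (toLatent B)

instance hyperKernel_posSemidef (B : LinMaps d D) : Fact (hyperKernel H B).PosSemidef :=
  ⟨(RKHS.posSemidef_kernel H).submatrix _⟩

/-- `H_B`, the RKHS on `X` with reproducing kernel `k_B`. -/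
abbrev HyperRKHS (B : LinMaps d D) : Type := RKHS.OfKernel (hyperKernel H B)

end Hyper

section Learning

variable {d D : ℕ} {X : Set (Eucl D)}

/-- The expected risk `𝓡(f) = 𝔼[(f(x) - y)²]`. -/
def risk (ρ : Measure (X × ℝ)) (f : X → ℝ) : ℝ := ∫ z, (f z.1 - z.2) ^ 2 ∂ρ

/-- The regression function `f_*(x) = ∫ y dρ(y | x)`. -/
def regressionFun (ρ : Measure (X × ℝ)) [IsFiniteMeasure ρ] (x : X) : ℝ :=
  ∫ y, y ∂(ρ.condKernel x)

/-- The empirical risk of `f` on the sample `z = (x_i, y_i)_{i < m}`. -/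
def empRisk {m : ℕ} (z : Fin m → X × ℝ) (f : X → ℝ) : ℝ :=
  (1 / m : ℝ) * ∑ i, (f (z i).1 - (z i).2) ^ 2

variable (H : Type*) [NormedAddCommGroup H] [InnerProductSpace ℝ H] [CompleteSpace H]
  [RKHS ℝ H (latent d X) ℝ]

/-- The regularized empirical risk of `f ∈ H_B`. -/
def regEmpRisk (lam : ℝ) {m : ℕ} (z : Fin m → X × ℝ) (B : LinMaps d D) (f : HyperRKHS H B) : ℝ :=
  empRisk z f + lam * ‖f‖ ^ 2

/-- `(B, f)` with `B ∈ ℬ`, `f ∈ H_B` solves the HKRR problem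
`min_{B ∈ ℬ} min_{f ∈ H_B} (regularized empirical risk)`. -/
def IsHKRR (lam : ℝ) {m : ℕ} (z : Fin m → X × ℝ) (B : LinMaps d D) (f : HyperRKHS H B) : Prop :=
  ∀ (B' : LinMaps d D) (f' : HyperRKHS H B'),
    regEmpRisk H lam z B f ≤ regEmpRisk H lam z B' f'

/-- The approximation error
`𝒜(lam) = inf_{f ∈ H_B} 𝓡(f) - 𝓡(f_*) + lam ‖f‖²`. -/
def approxError (ρ : Measure (X × ℝ)) [IsFiniteMeasure ρ] (B : LinMaps d D) (lam : ℝ) : ℝ :=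
  ⨅ f : HyperRKHS H B, (risk ρ f - risk ρ (regressionFun ρ) + lam * ‖f‖ ^ 2)

end Learning

/-- The constant `C₃ = 360 max{1, M + κ}² (1 + c₁ + max{0, log (3 C_H)})`. -/
def constC₃ (M κ c₁ CH : ℝ) : ℝ :=
  360 * max 1 (M + κ) ^ 2 * (1 + c₁ + max 0 (Real.log (3 * CH)))

end HKRR

end

/-! Since `regressionFun` is the conditional mean, the excess loss of `f` has mean `excessRisk ρ f`,
the squared distance to the regression function. It factors as that difference times a factor
bounded by `a + 3 * M`, so its second moment is at most a constant times its mean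
(`integral_sq_excessLoss_le`). A Chernoff bound then compares means with empirical means up to a
multiplicative constant and a term of order `1 / m`, rather than `1 / √m`.

Comparison with the zero function gives the estimator norm at most `R = M / √lam`. Every element of
every `H_B` is `g ∘ B` with `g` of the same norm in the mother space, so a net of the union of these
balls arises from a net for `g` and a net for `B` (`exists_net_hyperRKHS`). A union bound over it,
with minimality of the estimator against a near minimizer in `H_{B_*}`, yields the oracle inequality
`IsHKRR.excessRisk_le`.

At `τ = m ^ (-1 / (s + 1))` the entropy term `τ ^ (-s) / m` equals the discretization scale `τ`. The
net of matrices adds `D * d * log (1 / τ)`, which threatens an extra `log m`. It is absorbed by a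
dichotomy: covering segments of multiples of kernel sections shows `κ ≤ (τ * exp (c₁ * τ ^ (-s))) ^
2`, so `κ > τ` forces `log (1 / τ) ≤ 2 * c₁ * τ ^ (-s)`; if `κ ≤ τ`, all functions involved are so
small that the bound holds without concentration. -/

namespace HKRR

/-! ### Deviation inequalities under a variance condition -/

/-- One-sided Chernoff bound for sums of i.i.d. copies of a variable bounded by one. -/
theorem measure_pi_sum_ge_le {Z : Type*} [MeasurableSpace Z] (ρ : Measure Z)
    [IsProbabilityMeasure ρ] {ζ : Z → ℝ} (hζ : Measurable ζ) (hb : ∀ᵐ z ∂ρ, |ζ z| ≤ 1)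
    (m : ℕ) (t : ℝ) :
    Measure.pi (fun _ : Fin m => ρ)
      {z | m * (∫ z, ζ z ∂ρ + ∫ z, ζ z ^ 2 ∂ρ) + t ≤ ∑ i, ζ (z i)} ≤
      ENNReal.ofReal (Real.exp (-t)) := by
  set v := ∫ z, ζ z ∂ρ + ∫ z, ζ z ^ 2 ∂ρ with hv
  have hint : ∀ {f : Z → ℝ}, Measurable f → ∀ C : ℝ, (∀ᵐ z ∂ρ, |f z| ≤ C) → Integrable f ρ :=
    fun hf C h => Integrable.of_bound hf.aestronglyMeasurable C h
  have hI1 : Integrable ζ ρ := hint hζ 1 hb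
  have hI2 : Integrable (fun z => ζ z ^ 2) ρ := by
    refine hint (hζ.pow_const 2) 1 ?_
    filter_upwards [hb] with z hz
    rw [abs_pow]
    exact pow_le_one₀ (abs_nonneg _) hz
  have hIe : Integrable (fun z => Real.exp (ζ z)) ρ := by
    refine hint (Real.measurable_exp.comp hζ) (Real.exp 1) ?_
    filter_upwards [hb] with z hz
    rw [abs_of_pos (Real.exp_pos _)]
    exact Real.exp_le_exp.2 ((le_abs_self _).trans hz)
  -- On `[-1, 1]`, `exp x ≤ 1 + x + x ^ 2`; the exponential moment at parameter one is enough.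
  have hmgf : ∫ z, Real.exp (ζ z) ∂ρ ≤ Real.exp v := by
    calc ∫ z, Real.exp (ζ z) ∂ρ ≤ ∫ z, (1 + ζ z + ζ z ^ 2) ∂ρ := by
          refine integral_mono_ae hIe (((integrable_const 1).add hI1).add hI2) ?_
          filter_upwards [hb] with z hz
          have := (abs_le.1 (Real.abs_exp_sub_one_sub_id_le hz)).2
          linarith
      _ = 1 + v := by
          have h1 : ∫ z, (1 + ζ z + ζ z ^ 2) ∂ρ = ∫ z, (1 + ζ z) ∂ρ + ∫ z, ζ z ^ 2 ∂ρ :=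
            integral_add ((integrable_const 1).add hI1) hI2
          have h2 : ∫ z, (1 + ζ z) ∂ρ = ∫ _, (1 : ℝ) ∂ρ + ∫ z, ζ z ∂ρ :=
            integral_add (integrable_const 1) hI1
          rw [h1, h2, hv]
          simp [add_assoc]
      _ ≤ Real.exp v := by linarith [Real.add_one_le_exp v]
  have hexp : ∀ z : Fin m → Z, Real.exp (1 * ∑ i, ζ (z i)) = ∏ i, Real.exp (ζ (z i)) := fun z => by
    rw [one_mul, Real.exp_sum]
  have hIp : Integrable (fun z : Fin m → Z => Real.exp (1 * ∑ i, ζ (z i)))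
      (Measure.pi fun _ => ρ) := by
    simp_rw [hexp]
    exact Integrable.fintype_prod fun _ => hIe
  have key := measure_ge_le_exp_mul_mgf (μ := Measure.pi (fun _ : Fin m => ρ))
    (X := fun z => ∑ i, ζ (z i)) (m * v + t) zero_le_one hIp
  have hm : mgf (fun z : Fin m → Z => ∑ i, ζ (z i)) (Measure.pi fun _ => ρ) 1 ≤
      Real.exp (m * v) := by
    rw [mgf]
    simp_rw [hexp]
    rw [integral_fintype_prod_eq_pow (fun z => Real.exp (ζ z)), Fintype.card_fin, Real.exp_nat_mul]
    exact pow_le_pow_left₀ (integral_nonneg fun _ => (Real.exp_pos _).le) hmgf m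
  rw [← ofReal_measureReal]
  refine ENNReal.ofReal_le_ofReal (key.trans ?_)
  calc _ ≤ Real.exp (-1 * (m * v + t)) * Real.exp (m * v) :=
        mul_le_mul_of_nonneg_left hm (Real.exp_pos _).le
    _ = Real.exp (-t) := by rw [← Real.exp_add]; ring_nf

section Bernstein

variable {Z : Type*} [MeasurableSpace Z] (ρ : Measure Z) [IsProbabilityMeasure ρ] {ξ : Z → ℝ}
  {b : ℝ}

/-- Under the variance condition `𝔼 ξ² ≤ b 𝔼 ξ`, the mean is at most twice the empirical mean,
up to a term of order `1 / m`. -/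
theorem measure_pi_mean_gt_le (hξ : Measurable ξ) (hb0 : 0 < b) (hb : ∀ᵐ z ∂ρ, |ξ z| ≤ b)
    (hvar : ∫ z, ξ z ^ 2 ∂ρ ≤ b * ∫ z, ξ z ∂ρ) {m : ℕ} (hm : 0 < m) (t : ℝ) :
    Measure.pi (fun _ : Fin m => ρ)
      {z | 2 * ((1 / m : ℝ) * ∑ i, ξ (z i)) + 4 * b / m * t < ∫ z, ξ z ∂ρ} ≤
      ENNReal.ofReal (Real.exp (-t)) := by
  have hm' : (0 : ℝ) < m := by exact_mod_cast hm
  -- With the scaling `-1 / (2 * b)`, the second moment costs at most `e / (4 * b)`, half of the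
  -- gain `e / (2 * b)` from the mean; this produces the factor 2.
  refine (measure_mono fun z hz => ?_).trans
    (measure_pi_sum_ge_le ρ (ζ := fun z => -(1 / (2 * b)) * ξ z) (hξ.const_mul _) ?_ m t)
  · simp only [Set.mem_ofPred_eq, mul_pow, integral_const_mul, ← Finset.mul_sum] at hz ⊢
    set S := ∑ i, ξ (z i)
    set e := ∫ z, ξ z ∂ρ
    set q := ∫ z, ξ z ^ 2 ∂ρ
    have h1 : 2 * S + 4 * b * t < m * e := by
      have := mul_lt_mul_of_pos_left hz hm'
      field_simp at this
      linarith
    have h2 : (-(1 / (2 * b))) ^ 2 * q ≤ 1 / (4 * b) * e := by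
      calc (-(1 / (2 * b))) ^ 2 * q ≤ (-(1 / (2 * b))) ^ 2 * (b * e) := by gcongr
        _ = 1 / (4 * b) * e := by field_simp; ring
    calc m * (-(1 / (2 * b)) * e + (-(1 / (2 * b))) ^ 2 * q) + t
        ≤ m * (-(1 / (2 * b)) * e + 1 / (4 * b) * e) + t := by gcongr
      _ = (-(m * e) + 4 * b * t) / (4 * b) := by field_simp; ring
      _ ≤ (-2 * S) / (4 * b) := by gcongr; linarith
      _ = _ := by field_simp; ring
  · filter_upwards [hb] with z hz
    rw [abs_mul, abs_neg, abs_of_pos (by positivity : 0 < 1 / (2 * b))]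
    calc 1 / (2 * b) * |ξ z| ≤ 1 / (2 * b) * b := by gcongr
      _ ≤ 1 := by field_simp; norm_num

/-- Under the variance condition `𝔼 ξ² ≤ b 𝔼 ξ`, the empirical mean is at most `3 / 2` times the
mean, up to a term of order `1 / m`. -/
theorem measure_pi_mean_lt_le (hξ : Measurable ξ) (hb0 : 0 < b) (hb : ∀ᵐ z ∂ρ, |ξ z| ≤ b)
    (hvar : ∫ z, ξ z ^ 2 ∂ρ ≤ b * ∫ z, ξ z ∂ρ) {m : ℕ} (hm : 0 < m) (t : ℝ) :
    Measure.pi (fun _ : Fin m => ρ)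
      {z | 3 / 2 * ∫ z, ξ z ∂ρ + 2 * b / m * t < (1 / m : ℝ) * ∑ i, ξ (z i)} ≤
      ENNReal.ofReal (Real.exp (-t)) := by
  have hm' : (0 : ℝ) < m := by exact_mod_cast hm
  -- With the opposite sign the two contributions add up to `3 * e / (4 * b)`, whence the factor
  -- 3/2.
  refine (measure_mono fun z hz => ?_).trans
    (measure_pi_sum_ge_le ρ (ζ := fun z => (1 / (2 * b)) * ξ z) (hξ.const_mul _) ?_ m t)
  · simp only [Set.mem_ofPred_eq, mul_pow, integral_const_mul, ← Finset.mul_sum] at hz ⊢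
    set S := ∑ i, ξ (z i)
    set e := ∫ z, ξ z ∂ρ
    set q := ∫ z, ξ z ^ 2 ∂ρ
    have h1 : 3 * (m * e) + 4 * b * t < 2 * S := by
      have := mul_lt_mul_of_pos_left hz hm'
      field_simp at this
      linarith
    have h2 : (1 / (2 * b)) ^ 2 * q ≤ 1 / (4 * b) * e := by
      calc (1 / (2 * b)) ^ 2 * q ≤ (1 / (2 * b)) ^ 2 * (b * e) := by gcongr
        _ = 1 / (4 * b) * e := by field_simp; ring
    calc m * (1 / (2 * b) * e + (1 / (2 * b)) ^ 2 * q) + t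
        ≤ m * (1 / (2 * b) * e + 1 / (4 * b) * e) + t := by gcongr
      _ = (3 * (m * e) + 4 * b * t) / (4 * b) := by field_simp; ring
      _ ≤ (2 * S) / (4 * b) := by gcongr
      _ = _ := by field_simp; ring
  · filter_upwards [hb] with z hz
    rw [abs_mul, abs_of_pos (by positivity : 0 < 1 / (2 * b))]
    calc 1 / (2 * b) * |ξ z| ≤ 1 / (2 * b) * b := by gcongr
      _ ≤ 1 := by field_simp; norm_num

end Bernstein

/-! ### Nets of finite-dimensional unit balls -/

section Net

open Metric Module

variable {E : Type*} [NormedAddCommGroup E] [NormedSpace ℝ E] [FiniteDimensional ℝ E]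

/-- Volume bound for the cardinality of an `η`-separated subset of the unit ball. -/
theorem card_le_of_separated_unitBall {η : ℝ} (hη : 0 < η) (s : Finset E)
    (hs : ∀ c ∈ s, ‖c‖ ≤ 1) (h : ∀ c ∈ s, ∀ d ∈ s, c ≠ d → η ≤ ‖c - d‖) :
    (s.card : ℝ) ≤ (1 + 2 / η) ^ finrank ℝ E := by
  borelize E
  let μ : Measure E := Measure.addHaar
  have hr : 0 < η / 2 := by positivity
  have hr' : 0 < 1 + η / 2 := by positivity
  have D : Set.Pairwise (s : Set E) (Function.onFun Disjoint fun c => ball (c : E) (η / 2)) := by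
    rintro c hc d hd hcd
    apply ball_disjoint_ball
    rw [dist_eq_norm]
    linarith [h c hc d hd hcd]
  have hsub : (⋃ c ∈ s, ball (c : E) (η / 2)) ⊆ ball (0 : E) (1 + η / 2) := by
    refine Set.iUnion₂_subset fun x hx => ball_subset_ball' ?_
    rw [dist_zero_right]
    linarith [hs x hx]
  have I : (s.card : ℝ≥0∞) * ENNReal.ofReal ((η / 2) ^ finrank ℝ E) * μ (ball 0 1) ≤
      ENNReal.ofReal ((1 + η / 2) ^ finrank ℝ E) * μ (ball 0 1) := by
    rw [← μ.addHaar_ball_of_pos 0 hr']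
    refine le_trans (le_of_eq ?_) (measure_mono hsub)
    rw [measure_biUnion_finset D fun c _ => measurableSet_ball]
    simp only [μ.addHaar_ball_of_pos _ hr, Finset.sum_const, nsmul_eq_mul, mul_assoc]
  have J : (s.card : ℝ≥0∞) * ENNReal.ofReal ((η / 2) ^ finrank ℝ E) ≤
      ENNReal.ofReal ((1 + η / 2) ^ finrank ℝ E) :=
    (ENNReal.mul_le_mul_iff_left (measure_ball_pos _ _ zero_lt_one).ne' measure_ball_lt_top.ne).1 I
  have K : (s.card : ℝ) * (η / 2) ^ finrank ℝ E ≤ (1 + η / 2) ^ finrank ℝ E := by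
    have := ENNReal.toReal_le_of_le_ofReal (by positivity) J
    rwa [ENNReal.toReal_mul, ENNReal.toReal_natCast, ENNReal.toReal_ofReal (by positivity)] at this
  calc (s.card : ℝ) ≤ (1 + η / 2) ^ finrank ℝ E / (η / 2) ^ finrank ℝ E :=
        (le_div_iff₀ (by positivity)).2 K
    _ = (1 + 2 / η) ^ finrank ℝ E := by
        rw [← div_pow]; congr 1; field_simp; ring

/-- The unit ball of a normed space of dimension `n` has an internal `η`-net of cardinality at
most `max(1, 3 / η) ^ n`. -/
theorem exists_net_unitBall {η : ℝ} (hη : 0 < η) :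
    ∃ s : Finset E, (∀ c ∈ s, ‖c‖ ≤ 1) ∧ (∀ x : E, ‖x‖ ≤ 1 → ∃ c ∈ s, ‖x - c‖ ≤ η) ∧
      (s.card : ℝ) ≤ max 1 (3 / η) ^ finrank ℝ E := by
  -- For `η ≥ 1` the centre alone is a net; for `η < 1`, `1 + 2 / η ≤ 3 / η`.
  rcases le_or_gt 1 η with h1 | h1
  · refine ⟨{0}, by simp, fun x hx => ⟨0, by simp, by simpa using hx.trans h1⟩, ?_⟩
    simpa using one_le_pow₀ (le_max_left 1 (3 / η))
  set N := (1 + 2 / η) ^ finrank ℝ E with hN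
  set e : ℝ≥0 := ⟨η, hη.le⟩
  -- A larger separated set would contain one of exactly `⌊N⌋₊ + 1` points, against the volume
  -- bound.
  have hsep : packingNumber e (closedBall (0 : E) 1) ≤ (⌊N⌋₊ : ℕ∞) := by
    refine iSup_le fun C => iSup_le fun hC => iSup_le fun hsepC => ?_
    by_contra! hlt
    obtain ⟨t, htC, ht⟩ := Set.exists_subset_encard_eq (s := C) (k := (⌊N⌋₊ + 1 : ℕ))
      (by exact_mod_cast Order.add_one_le_of_lt hlt)
    have htfin : t.Finite := Set.finite_of_encard_eq_coe ht
    have hcard : htfin.toFinset.card = ⌊N⌋₊ + 1 := by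
      rw [← Set.ncard_eq_toFinset_card t htfin, Set.ncard, ht]; rfl
    have := card_le_of_separated_unitBall hη htfin.toFinset
      (fun c hc => by simpa using hC (htC ((Set.Finite.mem_toFinset _).1 hc)))
      (fun c hc d hd hcd => by
        have h2 := hsepC (htC ((Set.Finite.mem_toFinset _).1 hc))
          (htC ((Set.Finite.mem_toFinset _).1 hd)) hcd
        have h3 : (e : ℝ≥0∞) < edist c d := h2
        rw [edist_nndist, ENNReal.coe_lt_coe] at h3
        have h4 : η < dist c d := h3
        rw [dist_eq_norm] at h4
        exact h4.le)
    rw [hcard] at this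
    exact absurd (Nat.lt_floor_add_one N) (by push_cast at this; linarith)
  have hcov := (coveringNumber_le_packingNumber _ _).trans hsep
  obtain ⟨C, hCsub, hCfin, hCcov, hCcard⟩ := exists_set_encard_eq_coveringNumber
    (ne_top_of_le_ne_top (ENat.natCast_ne_top _) hcov)
  refine ⟨hCfin.toFinset, fun c hc => by simpa using hCsub ((Set.Finite.mem_toFinset _).1 hc),
    fun x hx => ?_, ?_⟩
  · obtain ⟨c, hc, hxc⟩ := hCcov (by simpa using hx : x ∈ closedBall (0 : E) 1)
    refine ⟨c, (Set.Finite.mem_toFinset _).2 hc, ?_⟩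
    have h3 : edist x c ≤ (e : ℝ≥0∞) := hxc
    rw [edist_nndist, ENNReal.coe_le_coe] at h3
    have h4 : dist x c ≤ η := h3
    rwa [dist_eq_norm] at h4
  · have hc : hCfin.toFinset.card ≤ ⌊N⌋₊ := by
      rw [← hCcard, hCfin.encard_eq_coe_toFinset_card] at hcov
      exact_mod_cast hcov
    calc (hCfin.toFinset.card : ℝ) ≤ ⌊N⌋₊ := by exact_mod_cast hc
      _ ≤ N := Nat.floor_le (by positivity)
      _ ≤ max 1 (3 / η) ^ finrank ℝ E := by
          refine pow_le_pow_left₀ (by positivity) ?_ _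
          refine le_trans ?_ (le_max_right _ _)
          rw [← sub_nonneg]
          have : 3 / η - (1 + 2 / η) = (1 - η) / η := by field_simp; ring
          rw [this]
          exact div_nonneg (by linarith) hη.le

end Net

/-! ### Pullbacks of reproducing kernel spaces -/

section Pullback

open Filter Topology

variable {S S' : Type*} {H H' : Type*}
  [NormedAddCommGroup H] [InnerProductSpace ℝ H] [CompleteSpace H] [RKHS ℝ H S ℝ]
  [NormedAddCommGroup H'] [InnerProductSpace ℝ H'] [CompleteSpace H'] [RKHS ℝ H' S' ℝ]

/-- If the kernel of `H'` is the pullback of the kernel of `H` along `φ`, then every element of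
`H'` is the pullback of an element of `H` of the same norm. -/
theorem exists_eq_comp_of_kernel_eq_submatrix (φ : S' → S)
    (hK : RKHS.kernel H' = (RKHS.kernel H).submatrix φ φ) (f : H') :
    ∃ g : H, ‖g‖ = ‖f‖ ∧ ∀ x, f x = g (φ x) := by
  -- `A c` and `T c` combine kernel sections at points and at their images under `φ`. The Gram
  -- matrices agree, so `A c ↦ T c` is isometric on a dense subspace and passes to limits.
  let A : (S' →₀ ℝ) →ₗ[ℝ] H' := Finsupp.linearCombination ℝ fun x => RKHS.kerFun H' x 1
  let T : (S' →₀ ℝ) →ₗ[ℝ] H := Finsupp.linearCombination ℝ fun x => RKHS.kerFun H (φ x) 1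
  have heval : ∀ c x, A c x = T c (φ x) := by
    intro c x
    induction c using Finsupp.induction_linear with
    | zero => simp
    | add c c' hc hc' => simp [hc, hc']
    | single y a =>
      simp [A, T, RKHS.kerFun_apply, hK]
  have hinner : ∀ c c', inner ℝ (A c) (A c') = inner ℝ (T c) (T c') := by
    intro c c'
    induction c' using Finsupp.induction_linear with
    | zero => simp
    | add c₁ c₂ h₁ h₂ => simp [inner_add_right, h₁, h₂]
    | single y a =>
      simp only [A, T, Finsupp.linearCombination_single, inner_smul_right, RKHS.inner_kerFun]
      congr 2
      exact heval c y
  have hnorm : ∀ c, ‖T c‖ = ‖A c‖ := fun c => by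
    rw [@norm_eq_sqrt_real_inner, @norm_eq_sqrt_real_inner, hinner]
  have hdense : f ∈ closure (Set.range A) := by
    have h := RKHS.kerFun_dense (𝕜 := ℝ) H'
    have hle : Submodule.span ℝ {x : H' | ∃ y v, RKHS.kerFun H' y v = x} ≤ LinearMap.range A := by
      refine Submodule.span_le.2 ?_
      rintro _ ⟨x, v, rfl⟩
      refine ⟨Finsupp.single x v, ?_⟩
      simp only [A, Finsupp.linearCombination_single]
      rw [← map_smul, smul_eq_mul, mul_one]
    have hf : f ∈ (Submodule.span ℝ {x : H' | ∃ y v, RKHS.kerFun H' y v = x}).topologicalClosure :=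
      h ▸ Submodule.mem_top
    exact closure_mono hle hf
  obtain ⟨u, hu, hlim⟩ := mem_closure_iff_seq_limit.1 hdense
  choose c hc using hu
  have hcauchy : CauchySeq fun n => T (c n) := by
    have h1 := hlim.cauchySeq
    rw [Metric.cauchySeq_iff] at h1 ⊢
    intro ε hε
    obtain ⟨N, hN⟩ := h1 ε hε
    refine ⟨N, fun k hk l hl => ?_⟩
    have := hN k hk l hl
    rwa [← hc, ← hc, dist_eq_norm, ← map_sub, ← hnorm, map_sub, ← dist_eq_norm] at this
  obtain ⟨g, hg⟩ := cauchySeq_tendsto_of_complete hcauchy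
  refine ⟨g, tendsto_nhds_unique hg.norm ?_, fun x => ?_⟩
  · simp_rw [hnorm, hc]
    exact hlim.norm
  · have h1 := ((RKHS.continuous_eval (H := H') x).tendsto f).comp hlim
    have h2 := ((RKHS.continuous_eval (H := H) (φ x)).tendsto g).comp hg
    refine tendsto_nhds_unique h1 (h2.congr fun n => ?_)
    simp [← heval, hc]

end Pullback

/-! ### Pointwise bounds from the kernel -/

section Kernel

variable {S : Type*} {H : Type*} [NormedAddCommGroup H] [InnerProductSpace ℝ H] [CompleteSpace H]
  [RKHS ℝ H S ℝ]

theorem kernelFun_self (u : S) : kernelFun H u u = ‖RKHS.kerFun H u (1 : ℝ)‖ ^ 2 := by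
  have := RKHS.kernel_inner H u u (1 : ℝ) (1 : ℝ)
  rw [real_inner_self_eq_norm_sq] at this
  rw [← this]
  simp [kernelFun]

theorem abs_apply_le_norm_kerFun (g : H) (u : S) : |g u| ≤ ‖RKHS.kerFun H u (1 : ℝ)‖ * ‖g‖ := by
  have := RKHS.kerFun_inner u (1 : ℝ) g
  simp only [RCLike.inner_apply, conj_trivial, mul_one] at this
  rw [← this]
  exact abs_real_inner_le_norm _ _

theorem kerFun_apply_self (u : S) : RKHS.kerFun H u (1 : ℝ) u = kernelFun H u u := by
  rw [RKHS.kerFun_apply]; rfl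

theorem kappa_nonneg : 0 ≤ kappa H :=
  Real.iSup_nonneg fun u => by rw [kernelFun_self]; positivity

theorem norm_kerFun_le_sqrt_kappa (hbdd : BddAbove (Set.range fun u : S => kernelFun H u u))
    (u : S) : ‖RKHS.kerFun H u (1 : ℝ)‖ ≤ √(kappa H) := by
  refine Real.le_sqrt_of_sq_le ?_
  rw [← kernelFun_self]
  exact le_ciSup hbdd u

theorem abs_apply_le (hbdd : BddAbove (Set.range fun u : S => kernelFun H u u)) (g : H) (u : S) :
    |g u| ≤ √(kappa H) * ‖g‖ :=
  (abs_apply_le_norm_kerFun g u).trans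
    (mul_le_mul_of_nonneg_right (norm_kerFun_le_sqrt_kappa hbdd u) (norm_nonneg _))

end Kernel

section Latent

variable {d D : ℕ} {X : Set (Eucl D)} {H : Type*} [NormedAddCommGroup H] [InnerProductSpace ℝ H]
  [RKHS ℝ H (latent d X) ℝ]

theorem norm_le_one_of_mem_latent (hX1 : ∀ x ∈ X, ‖x‖ ≤ 1) (u : latent d X) :
    ‖(u : Eucl d)‖ ≤ 1 := by
  obtain ⟨_, B, x, hx, rfl⟩ := u
  calc ‖B.1 x‖ ≤ ‖B.1‖ * ‖x‖ := B.1.le_opNorm x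
    _ ≤ 1 * 1 := mul_le_mul B.2 (hX1 x hx) (norm_nonneg _) zero_le_one
    _ = 1 := one_mul 1

variable {CH : ℝ}

theorem continuous_of_lipschitz
    (hLip : ∀ (g : H) (u v : latent d X),
      |g v - g u| ≤ CH * ‖g‖ * ‖(v : Eucl d) - (u : Eucl d)‖) (g : H) : Continuous g :=
  (LipschitzWith.of_dist_le' (K := CH * ‖g‖) fun v u => hLip g u v).continuous

variable [CompleteSpace H]

/-- The Lipschitz bound is applied to the kernel section `k` at `u` itself: `‖k‖ ^ 2 = k u ≤ |k u₀|
+ 2 * CH * ‖k‖ ≤ C * ‖k‖`. Without boundedness the real supremum `kappa` would take the default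
value 0. -/
theorem bddAbove_kernelFun (hX1 : ∀ x ∈ X, ‖x‖ ≤ 1) (hCH : 0 < CH)
    (hLip : ∀ (g : H) (u v : latent d X),
      |g v - g u| ≤ CH * ‖g‖ * ‖(v : Eucl d) - (u : Eucl d)‖) :
    BddAbove (Set.range fun u : latent d X => kernelFun H u u) := by
  rcases isEmpty_or_nonempty (latent d X) with h | ⟨⟨u₀⟩⟩
  · simp [Set.range_eq_empty]
  set C := ‖RKHS.kerFun H u₀ (1 : ℝ)‖ + CH * 2 with hC
  refine ⟨C ^ 2, ?_⟩
  rintro _ ⟨u, rfl⟩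
  set k := RKHS.kerFun H u (1 : ℝ) with hk
  have h1 : ‖k‖ ^ 2 ≤ C * ‖k‖ := by
    rw [← kernelFun_self, ← kerFun_apply_self, ← hk]
    have h2 := hLip k u₀ u
    have h3 := abs_apply_le_norm_kerFun k u₀
    have h4 : ‖(u : Eucl d) - u₀‖ ≤ 2 := by
      linarith [norm_sub_le (u : Eucl d) u₀, norm_le_one_of_mem_latent hX1 u,
        norm_le_one_of_mem_latent hX1 u₀]
    have h5 : CH * ‖k‖ * ‖(u : Eucl d) - u₀‖ ≤ CH * ‖k‖ * 2 := by gcongr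
    rw [hC]
    linarith [le_abs_self (k u - k u₀), le_abs_self (k u₀)]
  have h2 : ‖k‖ ≤ C := by
    rcases (norm_nonneg k).eq_or_lt with h | h
    · rw [← h]; positivity
    · nlinarith
  simp only [kernelFun_self]
  gcongr

/-- Elements of the mother space are bounded continuous functions. -/
theorem exists_mem_rkhsBall
    (hbdd : BddAbove (Set.range fun u : latent d X => kernelFun H u u))
    (hLip : ∀ (g : H) (u v : latent d X),
      |g v - g u| ≤ CH * ‖g‖ * ‖(v : Eucl d) - (u : Eucl d)‖) {R : ℝ} {g : H} (hg : ‖g‖ ≤ R) :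
    ∃ F ∈ rkhsBall (S := latent d X) H R, ∀ u, F u = g u :=
  ⟨.ofNormedAddCommGroup g (continuous_of_lipschitz hLip g) (√(kappa H) * ‖g‖)
    fun u => abs_apply_le hbdd g u, ⟨g, hg, fun _ => rfl⟩, fun _ => rfl⟩

theorem exists_eq_comp_toLatent (B : LinMaps d D) (f : HyperRKHS H B) :
    ∃ g : H, ‖g‖ = ‖f‖ ∧ ∀ x, f x = g (toLatent B x) :=
  exists_eq_comp_of_kernel_eq_submatrix (toLatent B)
    (by rw [RKHS.OfKernel.kernel_ofKernel]; rfl) f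

theorem continuous_toLatent (B : LinMaps d D) : Continuous (toLatent (X := X) B) :=
  (B.1.continuous.comp continuous_subtype_val).subtype_mk _

theorem measurable_hyperRKHS
    (hLip : ∀ (g : H) (u v : latent d X),
      |g v - g u| ≤ CH * ‖g‖ * ‖(v : Eucl d) - (u : Eucl d)‖) (B : LinMaps d D)
    (f : HyperRKHS H B) : Measurable f := by
  obtain ⟨g, -, hfg⟩ := exists_eq_comp_toLatent B f
  have : (f : X → ℝ) = g ∘ toLatent B := funext hfg
  rw [this]
  exact ((continuous_of_lipschitz hLip g).comp (continuous_toLatent B)).measurable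

theorem abs_hyperRKHS_apply_le
    (hbdd : BddAbove (Set.range fun u : latent d X => kernelFun H u u)) (B : LinMaps d D)
    (f : HyperRKHS H B) (x : X) : |f x| ≤ √(kappa H) * ‖f‖ := by
  obtain ⟨g, hg, hfg⟩ := exists_eq_comp_toLatent B f
  rw [hfg, ← hg]
  exact abs_apply_le hbdd g _

end Latent

/-! ### Nets of RKHS balls and of their union over matrices -/

section Covering

variable {S : Type*} [TopologicalSpace S] {H : Type*} [NormedAddCommGroup H]
  [InnerProductSpace ℝ H] [RKHS ℝ H S ℝ] {c₁ s : ℝ}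

theorem zero_mem_rkhsBall {R : ℝ} (hR : 0 ≤ R) : (0 : S →ᵇ ℝ) ∈ rkhsBall (S := S) H R :=
  ⟨0, by simpa using hR, fun u => by simp⟩

/-- A finite net of the ball of an RKHS provided by the covering number bound. -/
theorem CoveringBound.exists_net (hcov : CoveringBound (S := S) H c₁ s) {R ε : ℝ} (hR : 0 < R)
    (hε : 0 < ε) :
    ∃ T : Finset (S →ᵇ ℝ), (∀ F ∈ T, F ∈ rkhsBall H R) ∧
      (∀ G ∈ rkhsBall (S := S) H R, ∃ F ∈ T, dist G F ≤ ε) ∧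
      (T.card : ℝ) ≤ Real.exp (c₁ * (R / ε) ^ s) := by
  set e : ℝ≥0 := ⟨ε, hε.le⟩
  obtain ⟨hfin, hlog⟩ := hcov R hR e hε
  obtain ⟨C, hCsub, hCfin, hCcov, hCcard⟩ := Metric.exists_set_encard_eq_coveringNumber hfin
  refine ⟨hCfin.toFinset, fun F hF => hCsub ((Set.Finite.mem_toFinset _).1 hF),
    fun G hG => ?_, ?_⟩
  · obtain ⟨F, hF, hGF⟩ := hCcov hG
    refine ⟨F, (Set.Finite.mem_toFinset _).2 hF, ?_⟩
    have h3 : edist G F ≤ (e : ℝ≥0∞) := hGF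
    rw [edist_nndist, ENNReal.coe_le_coe] at h3
    exact h3
  -- As `Real.log 0 = 0`, exponentiating needs a nonempty net; it must cover the zero function.
  · have hpos : 0 < hCfin.toFinset.card := by
      obtain ⟨F, hF, -⟩ := hCcov (zero_mem_rkhsBall (S := S) (H := H) hR.le)
      exact Finset.card_pos.2 ⟨F, (Set.Finite.mem_toFinset _).2 hF⟩
    rw [← hCcard, hCfin.encard_eq_coe_toFinset_card, ENat.toNat_natCast] at hlog
    exact (Real.log_le_iff_le_exp (by exact_mod_cast hpos)).1 hlog

end Covering

section Nets

variable {d D : ℕ} {X : Set (Eucl D)} {H : Type*} [NormedAddCommGroup H] [InnerProductSpace ℝ H]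
  [CompleteSpace H] [RKHS ℝ H (latent d X) ℝ] {CH c₁ s : ℝ}

/-- The covering number of a ball dominates that of a segment of its elements. -/
theorem kappa_le_of_coveringBound
    (hbdd : BddAbove (Set.range fun u : latent d X => kernelFun H u u))
    (hLip : ∀ (g : H) (u v : latent d X),
      |g v - g u| ≤ CH * ‖g‖ * ‖(v : Eucl d) - (u : Eucl d)‖)
    (hcov : CoveringBound (S := latent d X) H c₁ s) {τ : ℝ} (hτ : 0 < τ) :
    kappa H ≤ (τ * Real.exp (c₁ * (1 / τ) ^ s)) ^ 2 := by
  refine Real.iSup_le (fun u => ?_) (by positivity)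
  rw [kernelFun_self]
  set q := ‖RKHS.kerFun H u (1 : ℝ)‖ with hq
  refine pow_le_pow_left₀ (norm_nonneg _) ?_ 2
  obtain ⟨T, -, hT, hcard⟩ := hcov.exists_net one_pos hτ
  suffices q ≤ τ * T.card from this.trans (by gcongr)
  -- Multiples of the kernel section at `u` in the unit ball take every value of `[-q, q]` at `u`,
  -- so the values at `u` of a `τ`-net centre intervals of length `2 * τ` covering this segment.
  -- Comparing lengths bounds `q`.
  have hsub : Set.Icc (-q) q ⊆ ⋃ F ∈ T, Metric.closedBall (F u) τ := by
    intro t ht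
    set g : H := (t / q ^ 2) • RKHS.kerFun H u (1 : ℝ) with hg
    have hgn : ‖g‖ ≤ 1 := by
      rw [hg, norm_smul, ← hq, Real.norm_eq_abs, abs_div, abs_of_nonneg (by positivity : 0 ≤ q ^ 2)]
      rcases (norm_nonneg (RKHS.kerFun H u (1 : ℝ))).eq_or_lt with h | h
      · rw [← hq] at h; simp [← h]
      · rw [← hq] at h
        have : |t| ≤ q := abs_le.2 ht
        calc |t| / q ^ 2 * q = |t| / q := by field_simp
          _ ≤ 1 := (div_le_one h).2 this
    have hgu : g u = t := by
      rw [hg, RKHS.coe_smul, Pi.smul_apply, kerFun_apply_self, kernelFun_self, ← hq, smul_eq_mul]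
      rcases eq_or_ne q 0 with h | h
      · rw [h] at ht
        have : t = 0 := le_antisymm ht.2 (by simpa using ht.1)
        simp [this]
      · field_simp
    obtain ⟨G, hG, hGg⟩ := exists_mem_rkhsBall hbdd hLip hgn
    obtain ⟨F, hF, hGF⟩ := hT G hG
    refine Set.mem_iUnion₂.2 ⟨F, hF, ?_⟩
    rw [Metric.mem_closedBall, ← hgu, ← hGg]
    exact (BoundedContinuousFunction.dist_coe_le_dist u).trans hGF
  have hvol : ENNReal.ofReal (2 * q) ≤ ENNReal.ofReal (T.card * (2 * τ)) := by
    calc ENNReal.ofReal (2 * q) = volume (Set.Icc (-q) q) := by rw [Real.volume_Icc]; ring_nf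
      _ ≤ ∑ F ∈ T, volume (Metric.closedBall (F u) τ) :=
          (measure_mono hsub).trans (measure_biUnion_finset_le _ _)
      _ = ENNReal.ofReal (T.card * (2 * τ)) := by
          simp only [Real.volume_closedBall, Finset.sum_const, nsmul_eq_mul]
          rw [ENNReal.ofReal_mul (p := (T.card : ℝ)) (by positivity), ENNReal.ofReal_natCast]
  have := (ENNReal.ofReal_le_ofReal_iff (by positivity)).1 hvol
  linarith

theorem finrank_eucl_continuousLinearMap (d D : ℕ) :
    Module.finrank ℝ (Eucl D →L[ℝ] Eucl d) = D * d := by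
  rw [← (LinearMap.toContinuousLinearMap (𝕜 := ℝ) (E := Eucl D) (F' := Eucl d)).finrank_eq,
    Module.finrank_linearMap]
  simp

/-- A finite net, in the sup norm, of the union over `B` of the balls of radius `R` of `H_B`. -/
theorem exists_net_hyperRKHS (hX1 : ∀ x ∈ X, ‖x‖ ≤ 1)
    (hbdd : BddAbove (Set.range fun u : latent d X => kernelFun H u u)) (hCH : 0 < CH)
    (hLip : ∀ (g : H) (u v : latent d X),
      |g v - g u| ≤ CH * ‖g‖ * ‖(v : Eucl d) - (u : Eucl d)‖)
    (hcov : CoveringBound (S := latent d X) H c₁ s) {R τ : ℝ} (hR : 0 < R) (hτ : 0 < τ) :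
    ∃ T : Finset (X → ℝ), (∀ h ∈ T, Measurable h ∧ ∀ x, |h x| ≤ √(kappa H) * R) ∧
      (∀ (B : LinMaps d D) (f : HyperRKHS H B), ‖f‖ ≤ R →
        ∃ h ∈ T, ∀ x, |f x - h x| ≤ 2 * R * τ) ∧
      (T.card : ℝ) ≤ Real.exp (c₁ * (1 / τ) ^ s) * max 1 (3 * CH / τ) ^ (D * d) := by
  classical
  -- The radii `R * τ` and `τ / CH` make both errors equal: moving the matrix costs `CH * R * (τ /
  -- CH) = R * τ`.
  obtain ⟨T₁, hT₁, hT₁net, hT₁card⟩ := hcov.exists_net hR (mul_pos hR hτ)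
  obtain ⟨T₂, hT₂, hT₂net, hT₂card⟩ :=
    exists_net_unitBall (E := Eucl D →L[ℝ] Eucl d) (div_pos hτ hCH)
  refine ⟨(T₁ ×ˢ T₂.attach).image fun p => p.1 ∘ toLatent ⟨p.2.1, hT₂ _ p.2.2⟩, ?_, ?_, ?_⟩
  · intro h hh
    obtain ⟨⟨F, B⟩, hp, rfl⟩ := Finset.mem_image.1 hh
    refine ⟨(F.continuous.comp (continuous_toLatent _)).measurable, fun x => ?_⟩
    obtain ⟨g, hg, hFg⟩ := hT₁ F (Finset.mem_product.1 hp).1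
    simp only [Function.comp_apply, hFg]
    exact (abs_apply_le hbdd g _).trans (by gcongr)
  · intro B f hf
    obtain ⟨g, hg, hfg⟩ := exists_eq_comp_toLatent B f
    obtain ⟨G, hG, hGg⟩ := exists_mem_rkhsBall hbdd hLip (hg.le.trans hf)
    obtain ⟨F, hF, hGF⟩ := hT₁net G hG
    obtain ⟨C, hC, hBC⟩ := hT₂net B.1 B.2
    refine ⟨_, Finset.mem_image.2 ⟨(F, ⟨C, hC⟩), by simp [hF], rfl⟩, fun x => ?_⟩
    set v := toLatent (X := X) ⟨C, hT₂ C hC⟩ x with hv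
    have h1 : |g v - G v| = 0 := by simp [hGg]
    have h2 : |G v - F v| ≤ R * τ := (BoundedContinuousFunction.dist_coe_le_dist v).trans hGF
    have h3 : |g (toLatent B x) - g v| ≤ R * τ := by
      have hx : ‖(toLatent B x : Eucl d) - v‖ ≤ τ / CH := by
        calc ‖(toLatent B x : Eucl d) - v‖ = ‖(B.1 - C) (x : Eucl D)‖ := rfl
          _ ≤ ‖B.1 - C‖ * ‖(x : Eucl D)‖ := (B.1 - C).le_opNorm _
          _ ≤ τ / CH * 1 :=
            mul_le_mul hBC (hX1 x x.2) (norm_nonneg _) (by positivity)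
          _ = τ / CH := mul_one _
      calc |g (toLatent B x) - g v| ≤ CH * ‖g‖ * ‖(toLatent B x : Eucl d) - v‖ := hLip _ _ _
        _ ≤ CH * R * (τ / CH) := by
          have := hg.le.trans hf
          gcongr
        _ = R * τ := by field_simp
    simp only [Function.comp_apply]
    rw [hfg]
    have h4 : g v = G v := (hGg v).symm
    calc |g (toLatent B x) - F v| = |(g (toLatent B x) - g v) + (G v - F v)| := by rw [h4]; ring_nf
      _ ≤ R * τ + R * τ := (abs_add_le _ _).trans (add_le_add h3 h2)
      _ = 2 * R * τ := by ring
  · calc _ ≤ ((T₁ ×ˢ T₂.attach).card : ℝ) := by exact_mod_cast Finset.card_image_le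
      _ = T₁.card * T₂.card := by rw [Finset.card_product, Finset.card_attach]; push_cast; rfl
      _ ≤ _ := by
        refine mul_le_mul (hT₁card.trans (le_of_eq ?_)) (hT₂card.trans (le_of_eq ?_))
          (by positivity) (by positivity)
        · congr 3; field_simp
        · rw [finrank_eucl_continuousLinearMap]; congr 2; field_simp

end Nets

/-! ### Excess loss and excess risk -/

section Risk

variable {D : ℕ} {X : Set (Eucl D)} {ρ : Measure (X × ℝ)} [IsProbabilityMeasure ρ] {M : ℝ}

theorem measurable_regressionFun : Measurable (regressionFun ρ) :=
  (stronglyMeasurable_id.integral_kernel (κ := ρ.condKernel)).measurable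

theorem abs_regressionFun_le (hy : ∀ᵐ z ∂ρ, |z.2| ≤ M) :
    ∀ᵐ z ∂ρ, |regressionFun ρ z.1| ≤ M := by
  have h1 : ∀ᵐ z ∂(ρ.fst ⊗ₘ ρ.condKernel), |z.2| ≤ M := by rwa [ρ.disintegrate]
  have h2 : ∀ᵐ x ∂ρ.fst, |regressionFun ρ x| ≤ M := by
    filter_upwards [Measure.ae_ae_of_ae_compProd h1] with x hx
    have := norm_integral_le_of_norm_le_const (μ := ρ.condKernel x) (f := fun y : ℝ => y) hx
    simpa [regressionFun] using this
  exact ae_of_ae_map measurable_fst.aemeasurable h2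

/-- The excess loss of `f` over the regression function. -/
noncomputable def excessLoss (ρ : Measure (X × ℝ)) [IsFiniteMeasure ρ] (f : X → ℝ) (z : X × ℝ) : ℝ :=
  (f z.1 - z.2) ^ 2 - (regressionFun ρ z.1 - z.2) ^ 2

/-- The squared distance in mean of `f` to the regression function. -/
noncomputable def excessRisk (ρ : Measure (X × ℝ)) [IsFiniteMeasure ρ] (f : X → ℝ) : ℝ :=
  ∫ z, (f z.1 - regressionFun ρ z.1) ^ 2 ∂ρ

theorem excessRisk_nonneg (f : X → ℝ) : 0 ≤ excessRisk ρ f :=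
  integral_nonneg fun _ => sq_nonneg _

variable {f : X → ℝ} {a : ℝ}

theorem measurable_excessLoss (hf : Measurable f) : Measurable (excessLoss ρ f) :=
  (((hf.comp measurable_fst).sub measurable_snd).pow_const 2).sub
    (((measurable_regressionFun.comp measurable_fst).sub measurable_snd).pow_const 2)

theorem integrable_of_abs_le {g : X × ℝ → ℝ} (hg : Measurable g) (C : ℝ)
    (h : ∀ᵐ z ∂ρ, |g z| ≤ C) : Integrable g ρ :=
  Integrable.of_bound hg.aestronglyMeasurable C h

theorem integrable_sq_sub_regressionFun (hy : ∀ᵐ z ∂ρ, |z.2| ≤ M) (hf : Measurable f)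
    (hfa : ∀ x, |f x| ≤ a) : Integrable (fun z => (f z.1 - regressionFun ρ z.1) ^ 2) ρ := by
  refine integrable_of_abs_le
    (((hf.comp measurable_fst).sub (measurable_regressionFun.comp measurable_fst)).pow_const 2)
    ((a + M) ^ 2) ?_
  filter_upwards [abs_regressionFun_le hy] with z hz
  rw [abs_pow]
  gcongr
  exact (abs_sub _ _).trans (add_le_add (hfa _) hz)

/-- Disintegration: for almost every `x` the inner integral of `regressionFun ρ x - y` is zero. This
kills the cross term in `integral_excessLoss`. -/
theorem integral_mul_sub_regressionFun_eq_zero (hy : ∀ᵐ z ∂ρ, |z.2| ≤ M) {h : X → ℝ}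
    (hh : Measurable h) {C : ℝ} (hC : ∀ᵐ z ∂ρ, |h z.1| ≤ C) :
    ∫ z, h z.1 * (regressionFun ρ z.1 - z.2) ∂ρ = 0 := by
  have hI : Integrable (fun z : X × ℝ => h z.1 * (regressionFun ρ z.1 - z.2)) ρ := by
    refine integrable_of_abs_le ((hh.comp measurable_fst).mul
      ((measurable_regressionFun.comp measurable_fst).sub measurable_snd)) (C * (M + M)) ?_
    filter_upwards [abs_regressionFun_le hy, hy, hC] with z hz hz' hz''
    rw [abs_mul]
    exact mul_le_mul hz'' ((abs_sub _ _).trans (add_le_add hz hz')) (abs_nonneg _)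
      ((abs_nonneg _).trans hz'')
  have hy' : ∀ᵐ x ∂ρ.fst, Integrable (fun y : ℝ => y) (ρ.condKernel x) :=
    (integrable_of_abs_le measurable_snd M hy).condKernel_ae
  rw [← Measure.integral_condKernel hI]
  refine integral_eq_zero_of_ae ?_
  filter_upwards [hy'] with x hx
  rw [integral_const_mul, integral_sub (integrable_const _) hx]
  simp [regressionFun]

theorem integral_excessLoss (hy : ∀ᵐ z ∂ρ, |z.2| ≤ M) (hf : Measurable f)
    (hfa : ∀ x, |f x| ≤ a) : ∫ z, excessLoss ρ f z ∂ρ = excessRisk ρ f := by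
  have h0 := integral_mul_sub_regressionFun_eq_zero hy (h := fun x => 2 * (f x - regressionFun ρ x))
    ((hf.sub measurable_regressionFun).const_mul 2) (C := 2 * (a + M)) (by
      filter_upwards [abs_regressionFun_le hy] with z hz
      rw [abs_mul, abs_two]
      gcongr
      exact (abs_sub _ _).trans (add_le_add (hfa _) hz))
  have hI := integrable_sq_sub_regressionFun hy hf hfa
  have hI' : Integrable (excessLoss ρ f) ρ := by
    refine integrable_of_abs_le (measurable_excessLoss hf) ((a + M) ^ 2 + (M + M) ^ 2) ?_
    filter_upwards [abs_regressionFun_le hy, hy] with z hz hz'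
    refine (abs_sub _ _).trans ?_
    rw [abs_pow, abs_pow]
    gcongr
    · exact (abs_sub _ _).trans (add_le_add (hfa _) hz')
    · exact (abs_sub _ _).trans (add_le_add hz hz')
  rw [← sub_eq_zero, excessRisk, ← integral_sub hI' hI, ← h0]
  refine integral_congr_ae (.of_forall fun z => ?_)
  simp only [excessLoss]
  ring

theorem risk_sub_risk_regressionFun (hy : ∀ᵐ z ∂ρ, |z.2| ≤ M) (hf : Measurable f)
    (hfa : ∀ x, |f x| ≤ a) : risk ρ f - risk ρ (regressionFun ρ) = excessRisk ρ f := by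
  rw [← integral_excessLoss hy hf hfa, risk, risk, ← integral_sub]
  · rfl
  · refine integrable_of_abs_le (((hf.comp measurable_fst).sub measurable_snd).pow_const 2)
      ((a + M) ^ 2) ?_
    filter_upwards [hy] with z hz
    rw [abs_pow]
    gcongr
    exact (abs_sub _ _).trans (add_le_add (hfa _) hz)
  · refine integrable_of_abs_le
      (((measurable_regressionFun.comp measurable_fst).sub measurable_snd).pow_const 2)
      ((M + M) ^ 2) ?_
    filter_upwards [abs_regressionFun_le hy, hy] with z hz hz'
    rw [abs_pow]
    gcongr
    exact (abs_sub _ _).trans (add_le_add hz hz')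

theorem excessLoss_eq_mul (z : X × ℝ) : excessLoss ρ f z =
    (f z.1 - regressionFun ρ z.1) * (f z.1 + regressionFun ρ z.1 - 2 * z.2) := by
  rw [excessLoss]; ring

theorem abs_add_regressionFun_sub_le (hfa : ∀ x, |f x| ≤ a) {z : X × ℝ}
    (hz : |regressionFun ρ z.1| ≤ M) (hz' : |z.2| ≤ M) :
    |f z.1 + regressionFun ρ z.1 - 2 * z.2| ≤ a + 3 * M := by
  have := abs_le.1 (hfa z.1)
  rw [abs_le] at hz hz' ⊢
  constructor <;> linarith

theorem abs_excessLoss_le (hM : 0 ≤ M) (hy : ∀ᵐ z ∂ρ, |z.2| ≤ M) (hfa : ∀ x, |f x| ≤ a) :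
    ∀ᵐ z ∂ρ, |excessLoss ρ f z| ≤ (a + 3 * M) ^ 2 := by
  filter_upwards [abs_regressionFun_le hy, hy] with z hz hz'
  rw [excessLoss_eq_mul, abs_mul, sq]
  have h1 := abs_add_regressionFun_sub_le hfa hz hz'
  refine mul_le_mul ?_ h1 (abs_nonneg _) ((abs_nonneg _).trans h1)
  exact (abs_sub _ _).trans (by linarith [hfa z.1])

/-- This is the variance condition of the deviation inequalities. The factor `f + regressionFun ρ -
2 * y` is at most `a + 3 * M` in absolute value, and the square of the other factor integrates to
the excess risk. -/
theorem integral_sq_excessLoss_le (hy : ∀ᵐ z ∂ρ, |z.2| ≤ M) (hf : Measurable f)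
    (hfa : ∀ x, |f x| ≤ a) :
    ∫ z, excessLoss ρ f z ^ 2 ∂ρ ≤ (a + 3 * M) ^ 2 * ∫ z, excessLoss ρ f z ∂ρ := by
  rw [integral_excessLoss hy hf hfa, excessRisk, ← integral_const_mul]
  refine integral_mono_of_nonneg (.of_forall fun z => sq_nonneg _)
    ((integrable_sq_sub_regressionFun hy hf hfa).const_mul _) ?_
  filter_upwards [abs_regressionFun_le hy, hy] with z hz hz'
  simp only [excessLoss_eq_mul, mul_pow]
  rw [mul_comm]
  refine mul_le_mul_of_nonneg_right ?_ (sq_nonneg _)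
  rw [← sq_abs]
  have h1 := abs_add_regressionFun_sub_le hfa hz hz'
  gcongr

theorem abs_excessLoss_sub_le {g : X → ℝ} (hfa : ∀ x, |f x| ≤ a) (hga : ∀ x, |g x| ≤ a) {ε : ℝ}
    (hfg : ∀ x, |f x - g x| ≤ ε) {z : X × ℝ} (hz : |z.2| ≤ M) :
    |excessLoss ρ f z - excessLoss ρ g z| ≤ ε * (2 * a + 2 * M) := by
  have h : excessLoss ρ f z - excessLoss ρ g z =
      (f z.1 - g z.1) * (f z.1 + g z.1 - 2 * z.2) := by
    simp only [excessLoss]; ring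
  rw [h, abs_mul]
  refine mul_le_mul (hfg _) ?_ (abs_nonneg _) ((abs_nonneg _).trans (hfg z.1))
  have h1 := abs_le.1 (hfa z.1)
  have h2 := abs_le.1 (hga z.1)
  rw [abs_le] at hz ⊢
  constructor <;> linarith

theorem excessRisk_le_add (hM : 0 ≤ M) (hy : ∀ᵐ z ∂ρ, |z.2| ≤ M) (hf : Measurable f)
    {g : X → ℝ} (hg : Measurable g) (hfa : ∀ x, |f x| ≤ a) (hga : ∀ x, |g x| ≤ a) {ε : ℝ}
    (hfg : ∀ x, |f x - g x| ≤ ε) :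
    excessRisk ρ f ≤ excessRisk ρ g + ε * (2 * a + 2 * M) := by
  have hI : ∀ {h : X → ℝ}, Measurable h → (∀ x, |h x| ≤ a) → Integrable (excessLoss ρ h) ρ :=
    fun hh hha => integrable_of_abs_le (measurable_excessLoss hh) _ (abs_excessLoss_le hM hy hha)
  rw [← integral_excessLoss hy hf hfa, ← integral_excessLoss hy hg hga, ← sub_le_iff_le_add',
    ← integral_sub (hI hf hfa) (hI hg hga)]
  calc _ ≤ ∫ _, ε * (2 * a + 2 * M) ∂ρ := by
        refine integral_mono_ae ((hI hf hfa).sub (hI hg hga)) (integrable_const _) ?_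
        filter_upwards [hy] with z hz
        exact (le_abs_self _).trans (abs_excessLoss_sub_le hfa hga hfg hz)
    _ = _ := by simp

/-- For small kernels no concentration is needed: `|f - g| ≤ 2 * a`, and `(x + y) ^ 2 ≤ 2 * x ^ 2 +
2 * y ^ 2`. -/
theorem excessRisk_le_two_mul_add (hy : ∀ᵐ z ∂ρ, |z.2| ≤ M) {g : X → ℝ} (hg : Measurable g)
    (hfa : ∀ x, |f x| ≤ a) (hga : ∀ x, |g x| ≤ a) :
    excessRisk ρ f ≤ 2 * excessRisk ρ g + 8 * a ^ 2 := by
  rw [excessRisk, excessRisk, ← integral_const_mul]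
  have hI := integrable_sq_sub_regressionFun hy hg hga
  calc ∫ z, (f z.1 - regressionFun ρ z.1) ^ 2 ∂ρ
      ≤ ∫ z, (2 * (g z.1 - regressionFun ρ z.1) ^ 2 + 8 * a ^ 2) ∂ρ := by
        refine integral_mono_of_nonneg (.of_forall fun z => sq_nonneg _)
          ((hI.const_mul 2).add (integrable_const _)) (.of_forall fun z => ?_)
        have h1 := abs_le.1 (hfa z.1)
        have h2 := abs_le.1 (hga z.1)
        have h3 : (f z.1 - g z.1) ^ 2 ≤ (2 * a) ^ 2 :=
          sq_le_sq' (by linarith) (by linarith)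
        show (f z.1 - regressionFun ρ z.1) ^ 2 ≤ _
        nlinarith [sq_nonneg ((f z.1 - g z.1) - (g z.1 - regressionFun ρ z.1))]
    _ = _ := by
        rw [integral_add (hI.const_mul 2) (integrable_const _)]
        simp

end Risk

/-! ### A priori norm bound and oracle inequality -/

section Estimator

variable {d D : ℕ} {X : Set (Eucl D)} {H : Type*} [NormedAddCommGroup H] [InnerProductSpace ℝ H]
  [CompleteSpace H] [RKHS ℝ H (latent d X) ℝ] {ρ : Measure (X × ℝ)} [IsProbabilityMeasure ρ]
  {M lam : ℝ} {m : ℕ}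

theorem norm_le_of_mul_sq_le (hM : 0 ≤ M) (hlam : 0 < lam) {r : ℝ}
    (h : lam * r ^ 2 ≤ M ^ 2) : r ≤ M / √lam := by
  rw [le_div_iff₀ (Real.sqrt_pos.2 hlam)]
  refine le_of_sq_le_sq ?_ hM
  rw [mul_pow, Real.sq_sqrt hlam.le]
  linarith

/-- An HKRR estimator has norm at most `M / √lam`. -/
theorem IsHKRR.norm_le (hM : 0 ≤ M) (hlam : 0 < lam) (hm : 0 < m) {z : Fin m → X × ℝ}
    (hz : ∀ i, |(z i).2| ≤ M) {B : LinMaps d D} {f : HyperRKHS H B} (hf : IsHKRR H lam z B f) :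
    ‖f‖ ≤ M / √lam := by
  have hm' : (0 : ℝ) < m := by exact_mod_cast hm
  refine norm_le_of_mul_sq_le hM hlam ?_
  have h1 := hf B 0
  have h2 : 0 ≤ empRisk z f :=
    mul_nonneg (by positivity) (Finset.sum_nonneg fun i _ => sq_nonneg _)
  have h3 : empRisk z (0 : HyperRKHS H B) ≤ M ^ 2 := by
    calc empRisk z (0 : HyperRKHS H B) ≤ (1 / m : ℝ) * ∑ _i : Fin m, M ^ 2 := by
          refine mul_le_mul_of_nonneg_left (Finset.sum_le_sum fun i _ => ?_) (by positivity)
          rw [RKHS.coe_zero, Pi.zero_apply, zero_sub, neg_sq, ← sq_abs]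
          exact pow_le_pow_left₀ (abs_nonneg _) (hz i) 2
      _ = M ^ 2 := by simp; field_simp
  simp only [regEmpRisk, norm_zero] at h1
  linarith

theorem empRisk_sub_empRisk (z : Fin m → X × ℝ) (f g : X → ℝ) :
    empRisk z f - empRisk z g =
      (1 / m : ℝ) * ∑ i, excessLoss ρ f (z i) - (1 / m : ℝ) * ∑ i, excessLoss ρ g (z i) := by
  simp only [empRisk, excessLoss, Finset.sum_sub_distrib]
  ring

/-- An almost minimizer of the regularized risk over `H_B`, of norm at most `M / √lam`. -/
theorem exists_near_minimizer (hM : 0 ≤ M) (hlam : 0 < lam) (hy : ∀ᵐ z ∂ρ, |z.2| ≤ M)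
    {B : LinMaps d D} {a : HyperRKHS H B → ℝ} (hmeas : ∀ f : HyperRKHS H B, Measurable f)
    (ha : ∀ (f : HyperRKHS H B) x, |f x| ≤ a f) {η : ℝ} (hη : 0 < η) :
    ∃ f : HyperRKHS H B, ‖f‖ ≤ M / √lam ∧
      excessRisk ρ f + lam * ‖f‖ ^ 2 ≤ approxError H ρ B lam + η := by
  have hJ : ∀ f : HyperRKHS H B, risk ρ f - risk ρ (regressionFun ρ) = excessRisk ρ f :=
    fun f => risk_sub_risk_regressionFun hy (hmeas f) (ha f)
  have h0 : excessRisk ρ (0 : HyperRKHS H B) ≤ M ^ 2 := by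
    rw [excessRisk]
    calc _ ≤ ∫ _, M ^ 2 ∂ρ := by
          refine integral_mono_of_nonneg (.of_forall fun z => sq_nonneg _) (integrable_const _) ?_
          filter_upwards [abs_regressionFun_le hy] with z hz
          rw [RKHS.coe_zero, Pi.zero_apply, zero_sub, neg_sq, ← sq_abs]
          exact pow_le_pow_left₀ (abs_nonneg _) hz 2
      _ = M ^ 2 := by simp
  obtain ⟨f, hf⟩ := exists_lt_of_ciInf_lt (lt_add_of_pos_right (approxError H ρ B lam) hη)
  rw [hJ] at hf
  -- If the value at `f` exceeds `M ^ 2`, the zero function does better and replaces it.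
  rcases le_or_gt (excessRisk ρ f + lam * ‖f‖ ^ 2) (M ^ 2) with h | h
  · refine ⟨f, norm_le_of_mul_sq_le hM hlam ?_, hf.le⟩
    linarith [excessRisk_nonneg (ρ := ρ) f]
  · refine ⟨0, by rw [norm_zero]; positivity, ?_⟩
    rw [norm_zero]
    linarith

theorem approxError_nonneg (hlam : 0 < lam) (hy : ∀ᵐ z ∂ρ, |z.2| ≤ M)
    {B : LinMaps d D} {a : HyperRKHS H B → ℝ} (hmeas : ∀ f : HyperRKHS H B, Measurable f)
    (ha : ∀ (f : HyperRKHS H B) x, |f x| ≤ a f) : 0 ≤ approxError H ρ B lam := by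
  refine Real.iInf_nonneg fun f => ?_
  rw [risk_sub_risk_regressionFun hy (hmeas f) (ha f)]
  have := excessRisk_nonneg (ρ := ρ) f
  positivity

/-- The oracle inequality for HKRR estimators on the event where the empirical excess risks of a
net and of a comparison function concentrate. -/
theorem IsHKRR.excessRisk_le (hM : 0 ≤ M) (hm : 0 < m) (hlam : 0 < lam)
    (hy : ∀ᵐ z ∂ρ, |z.2| ≤ M) {z : Fin m → X × ℝ} (hz : ∀ i, |(z i).2| ≤ M)
    {Bhat B : LinMaps d D} {fhat : HyperRKHS H Bhat} {f : HyperRKHS H B} {h : X → ℝ}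
    (hfhat : IsHKRR H lam z Bhat fhat) {a ε p q : ℝ}
    (hmeas : Measurable fhat) (hh : Measurable h)
    (hfa : ∀ x, |fhat x| ≤ a) (hha : ∀ x, |h x| ≤ a) (hfh : ∀ x, |fhat x - h x| ≤ ε)
    (hp : excessRisk ρ h ≤ 2 * ((1 / m : ℝ) * ∑ i, excessLoss ρ h (z i)) + p)
    (hq : (1 / m : ℝ) * ∑ i, excessLoss ρ f (z i) ≤ 3 / 2 * excessRisk ρ f + q) :
    excessRisk ρ fhat ≤
      3 * (excessRisk ρ f + lam * ‖f‖ ^ 2) + 3 * (ε * (2 * a + 2 * M)) + p + 2 * q := by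
  have hm' : (0 : ℝ) < m := by exact_mod_cast hm
  -- With `e = ε * (2 * a + 2 * M)` and hats for empirical means, the chain is `E fhat ≤ E h + e ≤ 2
  -- Ê h + p + e ≤ 2 Ê fhat + p + 3 e`. Minimality then gives `Ê fhat ≤ Ê f + lam ‖f‖²`, and `2 Ê f
  -- ≤ 3 E f + 2 q`.
  have h1 := excessRisk_le_add hM hy hmeas hh hfa hha hfh
  have h2 : (1 / m : ℝ) * ∑ i, excessLoss ρ h (z i) ≤
      (1 / m : ℝ) * ∑ i, excessLoss ρ fhat (z i) + ε * (2 * a + 2 * M) := by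
    calc (1 / m : ℝ) * ∑ i, excessLoss ρ h (z i)
        ≤ (1 / m : ℝ) * ∑ i, (excessLoss ρ fhat (z i) + ε * (2 * a + 2 * M)) := by
          refine mul_le_mul_of_nonneg_left (Finset.sum_le_sum fun i _ => ?_) (by positivity)
          have := (abs_le.1 (abs_excessLoss_sub_le (ρ := ρ) hfa hha hfh (hz i))).1
          linarith
      _ = _ := by
          rw [Finset.sum_add_distrib, mul_add]
          simp
          field_simp
  have h3 := hfhat B f
  have h4 := empRisk_sub_empRisk (ρ := ρ) z fhat f
  simp only [regEmpRisk] at h3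
  have h5 : 0 ≤ lam * ‖fhat‖ ^ 2 := by positivity
  have h6 : 0 ≤ lam * ‖f‖ ^ 2 := by positivity
  linarith

end Estimator

/-! ### Numerical constants and the choice of scale -/

section Constants

variable {M κ lam P W τ R : ℝ}

theorem sqrt_le_add_quarter (hκ : 0 ≤ κ) : √κ ≤ κ + 1 / 4 := by
  nlinarith [Real.sq_sqrt hκ, sq_nonneg (√κ - 1 / 2)]

theorem radius_le (hlam : 0 < lam) : M / √lam ≤ √(max 1 (M ^ 2 / lam)) := by
  refine Real.le_sqrt_of_sq_le ?_
  rw [div_pow, Real.sq_sqrt hlam.le]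
  exact le_max_right _ _

/-- Bound on the range of the excess loss. -/
theorem range_sq_le (hM : 0 < M) (hκ : 0 ≤ κ) (hlam : 0 < lam) :
    (√κ * (M / √lam) + 3 * M) ^ 2 ≤ 11 * (max 1 (M + κ) ^ 2 * max 1 (M ^ 2 / lam)) := by
  set P := max 1 (M + κ) with hP
  set W := max 1 (M ^ 2 / lam) with hW
  have hP1 : 1 ≤ P := le_max_left _ _
  have hPM : M + κ ≤ P := le_max_right _ _
  have hW1 : 1 ≤ W := le_max_left _ _
  have hw1 : 1 ≤ √W := Real.one_le_sqrt.2 hW1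
  have hR := radius_le (M := M) hlam
  rw [← hW] at hR
  have hs := sqrt_le_add_quarter hκ
  -- `κ + 3 * M ≤ 3 * P` and `1 / 4 ≤ P / 4` give 13/4, whose square is below 11.
  have h1 : √κ * (M / √lam) + 3 * M ≤ 13 / 4 * P * √W := by
    calc √κ * (M / √lam) + 3 * M ≤ (κ + 1 / 4) * √W + 3 * M * √W := by
          refine add_le_add (mul_le_mul hs hR (by positivity) (by positivity)) ?_
          exact le_mul_of_one_le_right (by positivity) hw1
      _ = (κ + 1 / 4 + 3 * M) * √W := by ring
      _ ≤ 13 / 4 * P * √W := by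
          gcongr
          linarith
  calc _ ≤ (13 / 4 * P * √W) ^ 2 := pow_le_pow_left₀ (by positivity) h1 2
    _ = 169 / 16 * (P ^ 2 * W) := by rw [mul_pow, Real.sq_sqrt (by positivity)]; ring
    _ ≤ 11 * (P ^ 2 * W) := by gcongr; norm_num

theorem radius_mul_le (hM : 0 < M) (hκ : 0 ≤ κ) (hlam : 0 < lam) :
    M / √lam * (√κ * (M / √lam) + M) ≤ 5 / 4 * (max 1 (M + κ) ^ 2 * max 1 (M ^ 2 / lam)) := by
  set P := max 1 (M + κ) with hP
  set W := max 1 (M ^ 2 / lam) with hW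
  have hP1 : 1 ≤ P := le_max_left _ _
  have hPM : M + κ ≤ P := le_max_right _ _
  have hW1 : 1 ≤ W := le_max_left _ _
  have hw1 : 1 ≤ √W := Real.one_le_sqrt.2 hW1
  have hR := radius_le (M := M) hlam
  rw [← hW] at hR
  have hs := sqrt_le_add_quarter hκ
  have h1 : √κ * (M / √lam) + M ≤ 5 / 4 * P * √W := by
    calc √κ * (M / √lam) + M ≤ (κ + 1 / 4) * √W + M * √W := by
          refine add_le_add (mul_le_mul hs hR (by positivity) (by positivity)) ?_
          exact le_mul_of_one_le_right hM.le hw1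
      _ = (κ + 1 / 4 + M) * √W := by ring
      _ ≤ 5 / 4 * P * √W := by
          gcongr
          linarith
  calc _ ≤ √W * (5 / 4 * P * √W) := mul_le_mul hR h1 (by positivity) (by positivity)
    _ = 5 / 4 * (P * (√W) ^ 2) := by ring
    _ = 5 / 4 * (P * W) := by rw [Real.sq_sqrt (by positivity)]
    _ ≤ 5 / 4 * (P ^ 2 * W) := by gcongr; exact le_self_pow₀ hP1 two_ne_zero

theorem log_max_one_div_le {CH : ℝ} (hCH : 0 < CH) (hτ : 0 < τ) (hτ1 : τ ≤ 1) :
    Real.log (max 1 (3 * CH / τ)) ≤ max 0 (Real.log (3 * CH)) + Real.log (1 / τ) := by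
  have h0 : 0 ≤ Real.log (1 / τ) := Real.log_nonneg ((one_le_div hτ).2 hτ1)
  rcases le_total (3 * CH / τ) 1 with h | h
  · rw [max_eq_left h, Real.log_one]
    positivity
  · rw [max_eq_right h, div_eq_mul_one_div, Real.log_mul (by positivity) (by positivity)]
    gcongr
    exact le_max_right _ _

/-- The balance fixing `τ`: for `x = 1 / m`, entropy over sample size equals the scale of the net.
-/
theorem one_div_mul_rpow_eq {x s : ℝ} (hx : 0 < x) (hs : 0 < s) :
    x * (1 / x ^ (1 / (s + 1))) ^ s = x ^ (1 / (s + 1)) := by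
  rw [one_div (x ^ _), ← Real.rpow_neg hx.le, ← Real.rpow_mul hx.le]
  nth_rewrite 1 [← Real.rpow_one x]
  rw [← Real.rpow_add hx]
  congr 1
  field_simp
  ring

end Constants

section Bounds

variable {M κ c₁ CH lam A E L : ℝ} {n : ℕ}

/-- Numerical form of the oracle inequality at the scale `τ`, where `u = τ⁻ˢ`. -/
theorem oracle_bound_le {μ τ u G : ℝ} (hM : 0 < M) (hκ : 0 ≤ κ) (hlam : 0 < lam) (hc₁ : 0 < c₁)
    (hn : 1 ≤ n) (hμ : 0 < μ) (hμτ : μ ≤ τ) (hμu : μ * u = τ)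
    (hG : G ≤ max 0 (Real.log (3 * CH)) + 2 * c₁ * u)
    (hE : E ≤ 3 * (A + τ) +
      3 * (2 * (M / √lam) * τ * (2 * (√κ * (M / √lam)) + 2 * M)) +
      4 * (√κ * (M / √lam) + 3 * M) ^ 2 * μ * (c₁ * u + n * G + L) +
      2 * (2 * (√κ * (M / √lam) + 3 * M) ^ 2 * μ * L)) :
    E ≤ 3 * A + 2 * constC₃ M κ c₁ CH * max 1 (M ^ 2 / lam) * n * max 1 L * τ := by
  have hb := range_sq_le hM hκ hlam
  have hr := radius_mul_le hM hκ hlam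
  set Q := max 1 (M + κ) ^ 2 * max 1 (M ^ 2 / lam) with hQ
  set Λ := max 0 (Real.log (3 * CH)) with hΛ
  set b := (√κ * (M / √lam) + 3 * M) ^ 2
  set ℓ := max 1 L
  have hΛ0 : 0 ≤ Λ := le_max_left _ _
  have hℓ : 1 ≤ ℓ := le_max_left _ _
  have hLℓ : L ≤ ℓ := le_max_right _ _
  have hQ1 : 1 ≤ Q := one_le_mul_of_one_le_of_one_le (one_le_pow₀ (le_max_left _ _)) (le_max_left _ _)
  have hn' : (1 : ℝ) ≤ n := by exact_mod_cast hn
  have hτ : 0 < τ := hμ.trans_le hμτ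
  have hnℓ : (1 : ℝ) ≤ n * ℓ := one_le_mul_of_one_le_of_one_le hn' hℓ
  have hX : 1 ≤ n * ℓ * (1 + c₁ + Λ) := one_le_mul_of_one_le_of_one_le hnℓ (by linarith)
  have h1 : 3 * (2 * (M / √lam) * τ * (2 * (√κ * (M / √lam)) + 2 * M)) ≤ 15 * Q * τ := by
    calc _ = 12 * τ * (M / √lam * (√κ * (M / √lam) + M)) := by ring
      _ ≤ 12 * τ * (5 / 4 * Q) := by gcongr
      _ = _ := by ring
  have h2 : μ * (c₁ * u + n * G + 2 * L) ≤ 3 * (n * ℓ * (1 + c₁ + Λ)) * τ := by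
    calc μ * (c₁ * u + n * G + 2 * L) ≤ μ * (c₁ * u + n * (Λ + 2 * c₁ * u) + 2 * ℓ) := by gcongr
      _ = c₁ * (μ * u) + n * (μ * Λ + 2 * c₁ * (μ * u)) + 2 * ℓ * μ := by ring
      _ ≤ c₁ * τ + n * (τ * Λ + 2 * c₁ * τ) + 2 * ℓ * τ := by
          rw [hμu]
          gcongr
      _ = (c₁ * 1 + n * 1 * (Λ + 2 * c₁) + 2 * 1 * ℓ) * τ := by ring
      _ ≤ (c₁ * (n * ℓ) + n * ℓ * (Λ + 2 * c₁) + 2 * n * ℓ) * τ := by gcongr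
      _ = n * ℓ * (2 + 3 * c₁ + Λ) * τ := by ring
      _ ≤ n * ℓ * (3 * (1 + c₁ + Λ)) * τ := by
          gcongr
          linarith
      _ = _ := by ring
  have h3 : 4 * b * μ * (c₁ * u + n * G + L) + 2 * (2 * b * μ * L) ≤
      132 * Q * (n * ℓ * (1 + c₁ + Λ)) * τ := by
    calc _ = 4 * b * (μ * (c₁ * u + n * G + 2 * L)) := by ring
      _ ≤ 4 * b * (3 * (n * ℓ * (1 + c₁ + Λ)) * τ) := by gcongr
      _ ≤ 4 * (11 * Q) * (3 * (n * ℓ * (1 + c₁ + Λ)) * τ) := by gcongr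
      _ = _ := by ring
  have hconst : 2 * constC₃ M κ c₁ CH * max 1 (M ^ 2 / lam) * n * ℓ * τ =
      720 * (Q * (n * ℓ * (1 + c₁ + Λ)) * τ) := by
    rw [constC₃]; ring
  rw [hconst]
  set Y := Q * (n * ℓ * (1 + c₁ + Λ)) * τ with hY
  have h4 : Q * τ ≤ Y := by
    calc Q * τ = Q * 1 * τ := by ring
      _ ≤ Y := by rw [hY]; gcongr
  have h5 : τ ≤ Q * τ := le_mul_of_one_le_left hτ.le hQ1
  have h6 : 132 * Q * (n * ℓ * (1 + c₁ + Λ)) * τ = 132 * Y := by rw [hY]; ring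
  -- The error terms total at most `(3 + 15 + 132) * Y`, well below `720 * Y`.
  linarith

/-- Numerical form of the trivial bound for a kernel that is small at the scale `τ`. -/
theorem trivial_bound_le {τ : ℝ} (hκ : 0 ≤ κ) (hlam : 0 < lam) (hc₁ : 0 < c₁)
    (hn : 1 ≤ n) (hκτ : κ ≤ τ) (hτ : 0 < τ) (hA : 0 ≤ A)
    (hE : E ≤ 2 * (A + τ) + 8 * (√κ * (M / √lam)) ^ 2) :
    E ≤ 3 * A + 2 * constC₃ M κ c₁ CH * max 1 (M ^ 2 / lam) * n * max 1 L * τ := by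
  set P := max 1 (M + κ) ^ 2 with hP
  set W := max 1 (M ^ 2 / lam) with hW
  set ℓ := max 1 L
  set Λ := max 0 (Real.log (3 * CH)) with hΛ
  have hΛ0 : 0 ≤ Λ := le_max_left _ _
  have hP1 : 1 ≤ P := one_le_pow₀ (le_max_left _ _)
  have hW1 : 1 ≤ W := le_max_left _ _
  have hℓ : 1 ≤ ℓ := le_max_left _ _
  have hn' : (1 : ℝ) ≤ n := by exact_mod_cast hn
  have hX : 1 ≤ P * (n * ℓ * (1 + c₁ + Λ)) :=
    one_le_mul_of_one_le_of_one_le hP1 (one_le_mul_of_one_le_of_one_le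
      (one_le_mul_of_one_le_of_one_le hn' hℓ) (by linarith))
  have hconst : 2 * constC₃ M κ c₁ CH * W * n * ℓ * τ =
      720 * (W * (P * (n * ℓ * (1 + c₁ + Λ))) * τ) := by
    rw [constC₃]; ring
  have h1 : (√κ * (M / √lam)) ^ 2 ≤ W * τ := by
    calc (√κ * (M / √lam)) ^ 2 = M ^ 2 / lam * κ := by
          rw [mul_pow, div_pow, Real.sq_sqrt hκ, Real.sq_sqrt hlam.le]; ring
      _ ≤ W * τ := by
          gcongr
          exact le_max_right _ _
  have h2 : W * τ ≤ W * (P * (n * ℓ * (1 + c₁ + Λ))) * τ := by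
    gcongr
    exact le_mul_of_one_le_right (by positivity) hX
  have h3 : τ ≤ W * τ := le_mul_of_one_le_left hτ.le hW1
  rw [hconst]
  linarith

end Bounds

end HKRR

/-! ### The basic error bound -/

theorem mainTheorem6
    {d D : ℕ} (hd : 0 < d) (hdD : d < D)
    -- bounded data
    (X : Set (HKRR.Eucl D)) (hXc : IsCompact X) (hX1 : ∀ x ∈ X, ‖x‖ ≤ 1)
    (ρ : Measure (X × ℝ)) [IsProbabilityMeasure ρ]
    (M : ℝ) (hM : 0 < M) (hy : ∀ᵐ z ∂ρ, |z.2| ≤ M)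
    -- the mother RKHS on the latent set, with continuous kernel and uniformly Lipschitz elements
    (H : Type*) [NormedAddCommGroup H] [InnerProductSpace ℝ H] [CompleteSpace H]
    [RKHS ℝ H (HKRR.latent d X) ℝ]
    (hk : Continuous fun p : HKRR.latent d X × HKRR.latent d X => HKRR.kernelFun H p.1 p.2)
    (CH : ℝ) (hCH : 0 < CH)
    (hLip : ∀ (g : H) (u v : HKRR.latent d X),
      |g v - g u| ≤ CH * ‖g‖ * ‖(v : HKRR.Eucl d) - (u : HKRR.Eucl d)‖)
    -- covering numbers of the balls of the mother RKHS
    (c₁ s : ℝ) (hc₁ : 0 < c₁) (hs : 0 < s) (hcov : HKRR.CoveringBound H c₁ s)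
    -- the reference matrix, the regularization parameter, the sample size, the confidence
    (Bstar : HKRR.LinMaps d D) (lam : ℝ) (hlam : 0 < lam) (m : ℕ) (hm : 0 < m)
    (δ : ℝ) (hδ : 0 < δ) :
    -- the exceptional set of samples has (outer) probability at most `δ`
    Measure.pi (fun _ : Fin m => ρ)
      {z | ¬ ∀ (Bhat : HKRR.LinMaps d D) (fhat : HKRR.HyperRKHS H Bhat),
        HKRR.IsHKRR H lam z Bhat fhat →
        HKRR.risk ρ fhat - HKRR.risk ρ (HKRR.regressionFun ρ) ≤
          2 * HKRR.constC₃ M (HKRR.kappa H) c₁ CH * max 1 (M ^ 2 / lam) *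
              ((D : ℝ) * d) * max 1 (Real.log (2 / δ)) * (1 / (m : ℝ)) ^ (1 / (s + 1))
            + (4 + 28 * HKRR.kappa H ^ 2 * Real.log (2 / δ) / (3 * m * lam)) *
              HKRR.approxError H ρ Bstar lam
            + 84 * M ^ 2 * Real.log (2 / δ) / m}
      ≤ ENNReal.ofReal δ := by
  rcases le_or_gt 1 δ with hδ1 | hδ1
  · exact prob_le_one.trans (by rw [← ENNReal.ofReal_one]; exact ENNReal.ofReal_le_ofReal hδ1)
  have hm' : (0 : ℝ) < m := by exact_mod_cast hm
  have hμ : (0 : ℝ) < 1 / m := by positivity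
  set L := Real.log (2 / δ) with hL
  have hL0 : 0 ≤ L := Real.log_nonneg ((one_le_div hδ).2 (by linarith))
  set κ := HKRR.kappa H with hκdef
  have hκ : 0 ≤ κ := HKRR.kappa_nonneg
  set R := M / √lam with hR
  have hRpos : 0 < R := by positivity
  set a := √κ * R with ha
  set b := (a + 3 * M) ^ 2 with hb
  have hb0 : 0 < b := by positivity
  set τ := (1 / (m : ℝ)) ^ (1 / (s + 1)) with hτdef
  have hτ : 0 < τ := Real.rpow_pos_of_pos hμ _
  have hμ1 : 1 / (m : ℝ) ≤ 1 := (div_le_one hm').2 (by exact_mod_cast hm)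
  have hτ1 : τ ≤ 1 := Real.rpow_le_one hμ.le hμ1 (by positivity)
  set u := (1 / τ) ^ s with hu
  have hμu : 1 / (m : ℝ) * u = τ := HKRR.one_div_mul_rpow_eq hμ hs
  have hu1 : 1 ≤ u := Real.one_le_rpow ((one_le_div hτ).2 hτ1) hs.le
  have hμτ : 1 / (m : ℝ) ≤ τ := hμu ▸ le_mul_of_one_le_right hμ.le hu1
  have hbdd := HKRR.bddAbove_kernelFun (H := H) hX1 hCH hLip
  have hmeas : ∀ {B : HKRR.LinMaps d D} (f : HKRR.HyperRKHS H B), Measurable f :=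
    fun f => HKRR.measurable_hyperRKHS hLip _ f
  have hsup : ∀ {B : HKRR.LinMaps d D} (f : HKRR.HyperRKHS H B), ‖f‖ ≤ R → ∀ x, |f x| ≤ a :=
    fun f hf x => (HKRR.abs_hyperRKHS_apply_le hbdd _ f x).trans (by rw [ha]; gcongr)
  obtain ⟨T, hT, hTnet, hTcard⟩ := HKRR.exists_net_hyperRKHS hX1 hbdd hCH hLip hcov hRpos hτ
  have hA0 : 0 ≤ HKRR.approxError H ρ Bstar lam :=
    HKRR.approxError_nonneg hlam hy hmeas fun f => HKRR.abs_hyperRKHS_apply_le hbdd _ f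
  -- The slack `τ` has the order of the final bound, so the infimum need not be attained.
  obtain ⟨f, hfR, hfA⟩ := HKRR.exists_near_minimizer (B := Bstar) hM.le hlam hy hmeas
    (fun f => HKRR.abs_hyperRKHS_apply_le hbdd _ f) hτ
  set A := HKRR.approxError H ρ Bstar lam
  set G := Real.log (max 1 (3 * CH / τ)) with hG
  -- The first two terms dominate the log-cardinality of the net, so the union bound over it costs
  -- `exp (-L) = δ / 2`.
  set t := c₁ * u + (D * d : ℕ) * G + L with ht
  -- the exceptional events
  set bad₁ : (X → ℝ) → Set (Fin m → X × ℝ) := fun h =>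
    {z | 2 * ((1 / m : ℝ) * ∑ i, HKRR.excessLoss ρ h (z i)) + 4 * b / m * t <
      ∫ z, HKRR.excessLoss ρ h z ∂ρ} with hbad₁
  set bad₂ : Set (Fin m → X × ℝ) :=
    {z | 3 / 2 * ∫ z, HKRR.excessLoss ρ f z ∂ρ + 2 * b / m * L <
      (1 / m : ℝ) * ∑ i, HKRR.excessLoss ρ f (z i)} with hbad₂
  set bad₃ : Set (Fin m → X × ℝ) := {z | ¬ ∀ i, |(z i).2| ≤ M} with hbad₃
  have hP₁ : ∀ h ∈ T, Measure.pi (fun _ : Fin m => ρ) (bad₁ h) ≤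
      ENNReal.ofReal (Real.exp (-t)) := fun h hh =>
    HKRR.measure_pi_mean_gt_le ρ (HKRR.measurable_excessLoss (hT h hh).1) hb0
      (HKRR.abs_excessLoss_le hM.le hy (hT h hh).2)
      (HKRR.integral_sq_excessLoss_le hy (hT h hh).1 (hT h hh).2) hm t
  have hP₂ : Measure.pi (fun _ : Fin m => ρ) bad₂ ≤ ENNReal.ofReal (Real.exp (-L)) :=
    HKRR.measure_pi_mean_lt_le ρ (HKRR.measurable_excessLoss (hmeas f)) hb0
      (HKRR.abs_excessLoss_le hM.le hy (hsup f hfR))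
      (HKRR.integral_sq_excessLoss_le hy (hmeas f) (hsup f hfR)) hm L
  have hP₃ : Measure.pi (fun _ : Fin m => ρ) bad₃ = 0 := by
    have : ∀ᵐ z ∂(Measure.pi fun _ : Fin m => ρ), ∀ i, |(z i).2| ≤ M :=
      ae_all_iff.2 fun i => (Measure.tendsto_eval_ae_ae (μ := fun _ : Fin m => ρ)).eventually hy
    exact this
  have hexpL : Real.exp (-L) = δ / 2 := by
    rw [hL, Real.exp_neg, Real.exp_log (by positivity), inv_div]
  have hcardexp : T.card * Real.exp (-t) ≤ δ / 2 := by
    have h1 : Real.exp t =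
        Real.exp (c₁ * u) * max 1 (3 * CH / τ) ^ (D * d) * Real.exp L := by
      rw [ht, Real.exp_add, Real.exp_add, Real.exp_nat_mul, hG, Real.exp_log (by positivity)]
    calc T.card * Real.exp (-t)
        ≤ Real.exp (c₁ * u) * max 1 (3 * CH / τ) ^ (D * d) * Real.exp (-t) := by gcongr
      _ = Real.exp (-L) := by
          rw [Real.exp_neg t, h1, Real.exp_neg]
          have := (Real.exp_pos (c₁ * u)).ne'
          have := (Real.exp_pos L).ne'
          have : max 1 (3 * CH / τ) ^ (D * d) ≠ 0 := by positivity
          field_simp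
      _ = δ / 2 := hexpL
  have hunion : Measure.pi (fun _ : Fin m => ρ) ((⋃ h ∈ T, bad₁ h) ∪ bad₂ ∪ bad₃) ≤
      ENNReal.ofReal δ := by
    calc _ ≤ (∑ h ∈ T, Measure.pi (fun _ : Fin m => ρ) (bad₁ h)) +
          Measure.pi (fun _ : Fin m => ρ) bad₂ + Measure.pi (fun _ : Fin m => ρ) bad₃ :=
          (measure_union_le _ _).trans (add_le_add_left ((measure_union_le _ _).trans
            (add_le_add_left (measure_biUnion_finset_le _ _) _)) _)
      _ ≤ (∑ _h ∈ T, ENNReal.ofReal (Real.exp (-t))) + ENNReal.ofReal (Real.exp (-L)) + 0 :=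
          add_le_add (add_le_add (Finset.sum_le_sum hP₁) hP₂) hP₃.le
      _ = ENNReal.ofReal (T.card * Real.exp (-t)) + ENNReal.ofReal (Real.exp (-L)) := by
          rw [Finset.sum_const, nsmul_eq_mul, add_zero,
            ENNReal.ofReal_mul (p := (T.card : ℝ)) (by positivity), ENNReal.ofReal_natCast]
      _ = ENNReal.ofReal (T.card * Real.exp (-t) + Real.exp (-L)) :=
          (ENNReal.ofReal_add (by positivity) (Real.exp_pos _).le).symm
      _ ≤ ENNReal.ofReal δ := ENNReal.ofReal_le_ofReal (by rw [hexpL]; linarith)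
  refine (measure_mono fun z hz => ?_).trans hunion
  by_contra hgood
  simp only [Set.mem_union, not_or, Set.mem_iUnion, not_exists] at hgood
  obtain ⟨⟨hz₁, hz₂⟩, hz₃⟩ := hgood
  rw [hbad₃, Set.mem_ofPred_eq, not_not] at hz₃
  refine hz fun Bhat fhat hfhat => ?_
  have hhatR : ‖fhat‖ ≤ R := hfhat.norm_le hM.le hlam hm hz₃
  rw [HKRR.risk_sub_risk_regressionFun hy (hmeas fhat) (hsup fhat hhatR)]
  have hlam2 : 0 ≤ lam * ‖f‖ ^ 2 := by positivity
  have hDd : 1 ≤ D * d := Nat.mul_pos (hd.trans hdD) hd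
  have key : HKRR.excessRisk ρ fhat ≤ 3 * A + 2 * HKRR.constC₃ M κ c₁ CH * max 1 (M ^ 2 / lam) *
      (D * d : ℕ) * max 1 L * τ := by
    -- The dichotomy removing the logarithm: below, `τ < κ ≤ τ ^ 2 * exp (2 * c₁ * u)` bounds `log
    -- (1 / τ)`.
    rcases le_or_gt κ τ with hκτ | hκτ
    · refine HKRR.trivial_bound_le hκ hlam hc₁ hDd hκτ hτ hA0 ?_
      have := HKRR.excessRisk_le_two_mul_add hy (hmeas f) (hsup fhat hhatR) (hsup f hfR)
      linarith
    · have hlogτ : Real.log (1 / τ) ≤ 2 * c₁ * u := by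
        have h1 := hκτ.le.trans (HKRR.kappa_le_of_coveringBound hbdd hLip hcov hτ)
        have h2 : 1 / τ ≤ Real.exp (2 * c₁ * u) := by
          rw [div_le_iff₀ hτ]
          have h3 : (τ * Real.exp (c₁ * u)) ^ 2 = Real.exp (2 * c₁ * u) * τ * τ := by
            rw [mul_pow, ← Real.exp_nat_mul]
            push_cast
            ring_nf
          rw [h3] at h1
          exact le_of_mul_le_mul_right (by linarith) hτ
        exact (Real.log_le_iff_le_exp (by positivity)).2 h2
      obtain ⟨h, hhT, hfh⟩ := hTnet Bhat fhat hhatR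
      have hp := hz₁ h hhT
      have hq := hz₂
      simp only [hbad₁, hbad₂, Set.mem_ofPred_eq, not_lt] at hp hq
      rw [HKRR.integral_excessLoss hy (hT h hhT).1 (hT h hhT).2] at hp
      rw [HKRR.integral_excessLoss hy (hmeas f) (hsup f hfR)] at hq
      have horacle := hfhat.excessRisk_le hM.le hm hlam hy hz₃ (hmeas fhat) (hT h hhT).1
        (hsup fhat hhatR) (hT h hhT).2 hfh hp hq
      refine HKRR.oracle_bound_le (μ := 1 / m) (u := u) (G := G) hM hκ hlam hc₁ hDd hμ hμτ hμu
        ((HKRR.log_max_one_div_le hCH hτ hτ1).trans (by gcongr)) (horacle.trans ?_)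
      have e1 : 4 * b / m * t = 4 * b * (1 / m) * t := by ring
      have e2 : 2 * b / m * L = 2 * b * (1 / m) * L := by ring
      rw [e1, e2]
      gcongr
  -- `key` already has the smaller coefficient 3 on `A`; the remaining terms of the claim are
  -- nonnegative.
  have hcoef : 0 ≤ 28 * κ ^ 2 * L / (3 * m * lam) * A := by positivity
  have hlast : 0 ≤ 84 * M ^ 2 * L / m := by positivity
  push_cast at key
  linarith
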